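/- Theorem 2.2. Fix $n\ge 1$. A standard kernel with constants $A$ and $\varepsilon>0$ is a locally integrable function $K$, defined off the diagonal of $\mathbb{R}^n\times\mathbb{R}^n$, complex-valued, with $|K(x,y)|\le A|x-y|^{-n}$ for $x\ne y$ and $$|K(x,y)-K(z,y)|+|K(y,x)-K(y,z)|\le A\,\frac{|x-z|^{\varepsilon}}{|x-y|^{n+\varepsilon}}\quad\text{whenever } 2|x-z|<|x-y|.$$ A linear operator $T:C_c^\infty(\mathbb{R}^n)\to L^1_{loc}(\mathbb{R}^n)$ is a Calderón–Zygmund operator with kernel $K$ if $K$ is a standard kernel, $T$ extends to a bounded operator on $L^2(\mathbb{R}^n)$, and for every $\varphi\in C_c^\infty(\mathbb{R}^n)$ one has $T\varphi(x)=\int_{\mathbb{R}^n}K(x,y)\varphi(y)\,dy$ for almost every $x\notin\operatorname{supp}\varphi$. Its maximal singular integral operator is $$T^*f(x)=\sup_{\delta>0}\Big|\int_{|x-y|>\delta}K(x,y)f(y)\,dy\Big|,$$ and $Mf(x)=\sup_{Q\ni x}\frac1{|Q|}\int_Q|f(y)|\,dy$ is the Hardy–Littlewood maximal function, the supremum being over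 all cubes $Q$ (with sides parallel to the axes) that contain $x$. Let $A,B\in\mathbb{R}$ and $\varepsilon>0$. Then there are constants $c,\alpha>0$, depending only on $n$, $A$, $\varepsilon$ and $B$, such that for every Calderón–Zygmund operator $T$ on $\mathbb{R}^n$ whose kernel has constants $A,\varepsilon$ and whose extension to $L^2(\mathbb{R}^n)$ has norm at most $B$, every closed cube $Q\subset\mathbb{R}^n$ of positive side length, and every $f\in L^\infty(\mathbb{R}^n)$ that vanishes almost everywhere outside $Q$, $$|\{x\in Q: T^*f(x)>t\,Mf(x)\}|\le c\,e^{-\alpha t}\,|Q|,\qquad t>0.$$ -/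

import Mathlib

open MeasureTheory
open scoped ENNReal Distributions

/-- `ℝⁿ` with its Euclidean norm. -/
abbrev Rn (n : ℕ) : Type := EuclideanSpace ℝ (Fin n)

/-- The space `C_c^∞(ℝⁿ)` of complex-valued smooth compactly supported functions. -/
abbrev SmoothCc (n : ℕ) : Type := 𝓓((⊤ : TopologicalSpace.Opens (Rn n)), ℂ)

/-- The closed axis-parallel cube with lower corner `a` and side length `ℓ`. -/
def cube {n : ℕ} (a : Rn n) (ℓ : ℝ) : Set (Rn n) :=
  {x | ∀ i, x i ∈ Set.Icc (a i) (a i + ℓ)}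

/-- The (uncentred) Hardy--Littlewood maximal function: the supremum of the averages of `|f|` over
all cubes that contain `x`. -/
noncomputable def hlMaximal {n : ℕ} (f : Rn n → ℂ) (x : Rn n) : ℝ≥0∞ :=
  ⨆ (a : Rn n) (ℓ : ℝ) (_ : 0 < ℓ) (_ : x ∈ cube a ℓ), ⨍⁻ y in cube a ℓ, ‖f y‖ₑ ∂volume

/-- `K` is a standard kernel on `ℝⁿ × ℝⁿ` minus the diagonal, with constant `A` in the size and
regularity estimates and regularity exponent `ε`. The values `K x x` play no role. -/
structure IsStandardKernel {n : ℕ} (K : Rn n → Rn n → ℂ) (A ε : ℝ) : Prop where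
  locallyIntegrable :
    LocallyIntegrableOn (fun p : Rn n × Rn n => K p.1 p.2) {p | p.1 ≠ p.2}
  size : ∀ x y, x ≠ y → ‖K x y‖ ≤ A / ‖x - y‖ ^ n
  regularity : ∀ x y z, 2 * ‖x - z‖ < ‖x - y‖ →
    ‖K x y - K z y‖ + ‖K y x - K y z‖ ≤ A * ‖x - z‖ ^ ε / ‖x - y‖ ^ ((n : ℝ) + ε)

/-- The linear operator `T : C_c^∞(ℝⁿ) → L¹_loc(ℝⁿ)` is a Calderón--Zygmund operator with kernel
`K`; the kernel constants are `A` and `ε`, and `B` bounds the norm of `T` on `L²(ℝⁿ)`. Elements of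
`L¹_loc` are classes of functions modulo equality almost everywhere. -/
structure IsCalderonZygmund {n : ℕ} (T : SmoothCc n →ₗ[ℂ] (Rn n →ₘ[volume] ℂ))
    (K : Rn n → Rn n → ℂ) (A ε B : ℝ) : Prop where
  locallyIntegrable : ∀ φ : SmoothCc n, LocallyIntegrable (T φ) volume
  extends_L2 : ∃ S : Lp ℂ 2 (volume : Measure (Rn n)) →L[ℂ] Lp ℂ 2 (volume : Measure (Rn n)),
    ‖S‖ ≤ B ∧ ∀ (φ : SmoothCc n) (g : Lp ℂ 2 (volume : Measure (Rn n))),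
      g =ᵐ[volume] φ → S g =ᵐ[volume] T φ
  kernel : IsStandardKernel K A ε
  representation : ∀ φ : SmoothCc n, ∀ᵐ x, x ∉ tsupport φ → T φ x = ∫ y, K x y * φ y

/-- The truncated singular integral `∫_{|x - y| > δ} K(x, y) f(y) dy`. -/
noncomputable def truncatedIntegral {n : ℕ} (K : Rn n → Rn n → ℂ) (δ : ℝ) (f : Rn n → ℂ)
    (x : Rn n) : ℂ :=
  ∫ y in {y | δ < ‖x - y‖}, K x y * f y

/-- The maximal singular integral `T^* f(x) = sup_{δ > 0} |T_δ f(x)|` of the operator with kernel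
`K`, with values in `[0, ∞]`. -/
noncomputable def maximalSingularIntegral {n : ℕ} (K : Rn n → Rn n → ℂ) (f : Rn n → ℂ)
    (x : Rn n) : ℝ≥0∞ :=
  ⨆ (δ : ℝ) (_ : 0 < δ), ‖truncatedIntegral K δ f x‖ₑ

/-!
Cotlar's inequality gives the weak-type `(2,2)` bound for `T^*`, and a Calderón-Zygmund
decomposition then gives the weak-type `(1,1)` bound. Let `f` be supported in a fixed dilate of a
cube `Q`, and let `μ` be the mean of `|f|` over a larger cube, so that `μ ≤ C M f` on `Q`. For a
large `C`, the set `E` where `T^* f > 3 C μ` or `M f > C μ` has measure at most a small fraction of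
`|Q|`. The stopping cubes of `E` have total volume at most `|Q| / 2`, cover almost all of `E`, and
each contains a point off `E`. Comparing with such a point shows that on a stopping cube `Q'` the
part of `f` far from `Q'` contributes at most `C' M f` to `T^* f`; what remains is `T^*` of the
restriction of `f` to a dilate of `Q'`, and the argument applies again on `Q'`. After `k` steps
`T^* f` exceeds `k C' M f` only on a set of measure at most `2⁻¹ ^ k * |Q|`. This is used with
`k ≈ t / C'`.
-/

open scoped NNReal

/-- The half-open axis-parallel cube with lower corner `a` and side length `ℓ`. -/
def ocube {n : ℕ} (a : Rn n) (ℓ : ℝ) : Set (Rn n) :=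
  {x | ∀ i, x i ∈ Set.Ico (a i) (a i + ℓ)}

/-- The closed cube with centre `c` and half side length `r`, that is, the closed ball of radius `r`
in the supremum norm. -/
noncomputable def centredCube {n : ℕ} (c : Rn n) (r : ℝ) : Set (Rn n) :=
  cube (c - WithLp.toLp 2 (fun _ => r)) (2 * r)

/-- The uncentred maximal function of a nonnegative function `u`, over cubes; `hlMaximal f` is the
case `u = ‖f‖ₑ`, and the Cotlar inequality also uses `u = ‖f‖ₑ ^ 2`. -/
noncomputable def cubeMaximal {n : ℕ} (u : Rn n → ℝ≥0∞) (x : Rn n) : ℝ≥0∞ :=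
  ⨆ (a : Rn n) (ℓ : ℝ) (_ : 0 < ℓ) (_ : x ∈ cube a ℓ), ⨍⁻ y in cube a ℓ, u y ∂volume

section Cubes

variable {n : ℕ}

lemma ocube_subset_cube (a : Rn n) (ℓ : ℝ) : ocube a ℓ ⊆ cube a ℓ :=
  fun _ hx i => Set.Ico_subset_Icc_self (hx i)

lemma cube_eq_preimage_Icc (a : Rn n) (ℓ : ℝ) :
    cube a ℓ = WithLp.ofLp ⁻¹' Set.Icc a.ofLp fun i => a i + ℓ := by
  ext x
  simp [cube, Pi.le_def, forall_and]

lemma measurableSet_cube (a : Rn n) (ℓ : ℝ) : MeasurableSet (cube a ℓ) := by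
  rw [cube_eq_preimage_Icc]
  exact (PiLp.volume_preserving_ofLp (Fin n)).measurable measurableSet_Icc

lemma volume_cube (a : Rn n) (ℓ : ℝ) : volume (cube a ℓ) = ENNReal.ofReal ℓ ^ n := by
  rw [cube_eq_preimage_Icc, (PiLp.volume_preserving_ofLp (Fin n)).measure_preimage
    measurableSet_Icc.nullMeasurableSet]
  simp [Real.volume_Icc_pi]

lemma ocube_eq_preimage (a : Rn n) (ℓ : ℝ) :
    ocube a ℓ = WithLp.ofLp ⁻¹' Set.univ.pi fun i => Set.Ico (a i) (a i + ℓ) := by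
  ext x
  simp [ocube]

lemma measurableSet_ocube (a : Rn n) (ℓ : ℝ) : MeasurableSet (ocube a ℓ) := by
  rw [ocube_eq_preimage]
  exact (PiLp.volume_preserving_ofLp (Fin n)).measurable
    (MeasurableSet.univ_pi fun _ => measurableSet_Ico)

lemma mem_centredCube {c x : Rn n} {r : ℝ} : x ∈ centredCube c r ↔ ∀ i, |x i - c i| ≤ r := by
  refine forall_congr' fun i => ?_
  simp only [PiLp.sub_apply, Set.mem_Icc, abs_le]
  constructor <;> rintro ⟨h₁, h₂⟩ <;> constructor <;> linarith

lemma volume_centredCube (c : Rn n) (r : ℝ) :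
    volume (centredCube c r) = ENNReal.ofReal (2 * r) ^ n := volume_cube _ _

lemma cube_eq_centredCube (a : Rn n) (ℓ : ℝ) :
    cube a ℓ = centredCube (a + WithLp.toLp 2 fun _ => ℓ / 2) (ℓ / 2) := by
  rw [centredCube, add_sub_cancel_right, mul_div_cancel₀ ℓ two_ne_zero]

lemma centredCube_eq_preimage_closedBall (c : Rn n) {r : ℝ} (hr : 0 ≤ r) :
    centredCube c r = WithLp.ofLp ⁻¹' Metric.closedBall c.ofLp r := by
  ext x
  simp only [mem_centredCube, Set.mem_preimage, Metric.mem_closedBall, dist_pi_le_iff hr,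
    Real.dist_eq]

lemma norm_le_of_forall_abs_le {x : Rn n} {s : ℝ} (h : ∀ i, |x i| ≤ s) : ‖x‖ ≤ n * s := by
  rcases Nat.eq_zero_or_pos n with rfl | hn
  · simp [Subsingleton.elim x 0]
  have hs : 0 ≤ s := (abs_nonneg _).trans (h ⟨0, hn⟩)
  have hn1 : (1 : ℝ) ≤ n := by exact_mod_cast hn
  rw [EuclideanSpace.norm_eq]
  apply Real.sqrt_le_iff.2 ⟨by positivity, ?_⟩
  calc ∑ i, ‖x i‖ ^ 2 ≤ ∑ _i : Fin n, s ^ 2 := by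
        gcongr with i; exact h i
    _ = n * s ^ 2 := by simp
    _ ≤ (n * s) ^ 2 := by nlinarith [mul_nonneg (sub_nonneg.2 hn1) (sq_nonneg s)]

lemma norm_sub_le_of_mem_cube {a x y : Rn n} {ℓ : ℝ} (hx : x ∈ cube a ℓ) (hy : y ∈ cube a ℓ) :
    ‖x - y‖ ≤ n * ℓ := by
  refine norm_le_of_forall_abs_le fun i => ?_
  have hxi : a i ≤ x i ∧ x i ≤ a i + ℓ := hx i
  have hyi : a i ≤ y i ∧ y i ≤ a i + ℓ := hy i
  rw [PiLp.sub_apply, abs_le]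
  constructor <;> linarith

lemma closedBall_subset_centredCube (c : Rn n) (r : ℝ) :
    Metric.closedBall c r ⊆ centredCube c r := by
  intro x hx
  refine mem_centredCube.2 fun i => ?_
  rw [mem_closedBall_iff_norm] at hx
  exact (PiLp.norm_apply_le (x - c) i).trans hx

lemma interior_cube_nonempty (a : Rn n) {ℓ : ℝ} (hℓ : 0 < ℓ) : (interior (cube a ℓ)).Nonempty := by
  rw [cube_eq_centredCube]
  exact ⟨_, mem_interior_iff_mem_nhds.2 (Filter.mem_of_superset
    (Metric.closedBall_mem_nhds _ (half_pos hℓ)) (closedBall_subset_centredCube _ _))⟩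

lemma exists_disjoint_cubes_covering (t : Set (Rn n × ℝ)) (ht : ∀ q ∈ t, 0 < q.2) {R : ℝ}
    (hR : ∀ q ∈ t, q.2 ≤ R) :
    ∃ s ⊆ t, s.Countable ∧ s.PairwiseDisjoint (fun q => cube q.1 q.2) ∧
      ∀ q ∈ t, ∃ p ∈ s, cube q.1 q.2 ⊆ centredCube (p.1 + WithLp.toLp 2 fun _ => p.2 / 2)
        (5 * (p.2 / 2)) := by
  let ctr : Rn n × ℝ → Fin n → ℝ := fun q => (q.1 + WithLp.toLp 2 fun _ => q.2 / 2).ofLp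
  obtain ⟨s, hst, hdisj, hcov⟩ := Vitali.exists_disjoint_subfamily_covering_enlargement_closedBall
    t ctr (fun q => q.2 / 2) (R / 2) (fun q hq => by linarith [hR q hq]) 5 (by norm_num)
  have hcube : ∀ q ∈ t, cube q.1 q.2 = WithLp.ofLp ⁻¹' Metric.closedBall (ctr q) (q.2 / 2) :=
    fun q hq => by
      rw [cube_eq_centredCube, centredCube_eq_preimage_closedBall _ (half_pos (ht q hq)).le]
  have hdisj' : s.PairwiseDisjoint fun q => cube q.1 q.2 := fun p hp q hq hpq => by
    rw [Function.onFun, hcube p (hst hp), hcube q (hst hq)]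
    exact (hdisj hp hq hpq).preimage _
  refine ⟨s, hst, hdisj'.countable_of_nonempty_interior fun q hq =>
    interior_cube_nonempty _ (ht q (hst hq)), hdisj', fun q hq => ?_⟩
  obtain ⟨p, hp, hsub⟩ := hcov q hq
  have := ht p (hst hp)
  refine ⟨p, hp, ?_⟩
  rw [hcube q hq, centredCube_eq_preimage_closedBall _ (by positivity)]
  exact Set.preimage_mono hsub

end Cubes

section MaximalFunction

variable {n : ℕ}

lemma setLIntegral_cube_le (u : Rn n → ℝ≥0∞) {a x : Rn n} {ℓ : ℝ} (hℓ : 0 < ℓ)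
    (hx : x ∈ cube a ℓ) : ∫⁻ y in cube a ℓ, u y ≤ ENNReal.ofReal ℓ ^ n * cubeMaximal u x := by
  have h : ⨍⁻ y in cube a ℓ, u y ∂volume ≤ cubeMaximal u x :=
    le_iSup_of_le a (le_iSup_of_le ℓ (le_iSup_of_le hℓ (le_iSup_of_le hx le_rfl)))
  rw [setLAverage_eq, volume_cube] at h
  rw [mul_comm]
  exact (ENNReal.div_le_iff (pow_ne_zero _ (by simpa using hℓ)) (by finiteness)).1 h

lemma setLIntegral_closedBall_le (u : Rn n → ℝ≥0∞) {c p : Rn n} {r : ℝ} (hr : 0 < r)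
    (hp : ‖p - c‖ ≤ r) :
    ∫⁻ y in Metric.closedBall c r, u y ≤ ENNReal.ofReal (2 * r) ^ n * cubeMaximal u p :=
  (lintegral_mono_set (closedBall_subset_centredCube c r)).trans
    (setLIntegral_cube_le u (by positivity)
      (closedBall_subset_centredCube c r (mem_closedBall_iff_norm.2 hp)))

lemma cubeMaximal_le_of_forall {u : Rn n → ℝ≥0∞} {x : Rn n} {M : ℝ≥0∞}
    (h : ∀ (a : Rn n) (ℓ : ℝ), 0 < ℓ → x ∈ cube a ℓ →
      ∫⁻ y in cube a ℓ, u y ≤ M * ENNReal.ofReal ℓ ^ n) : cubeMaximal u x ≤ M := by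
  refine iSup_le fun a => iSup_le fun ℓ => iSup_le fun hℓ => iSup_le fun hx => ?_
  rw [setLAverage_eq, volume_cube]
  exact ENNReal.div_le_of_le_mul (h a ℓ hℓ hx)

lemma cubeMaximal_le_of_ae_le {u : Rn n → ℝ≥0∞} {M : ℝ≥0∞} (h : ∀ᵐ y, u y ≤ M) (x : Rn n) :
    cubeMaximal u x ≤ M :=
  cubeMaximal_le_of_forall fun a ℓ _ _ =>
    (lintegral_mono_ae (ae_restrict_of_ae h)).trans_eq (by simp [volume_cube])

lemma cubeMaximal_mono {u v : Rn n → ℝ≥0∞} (h : ∀ᵐ y, u y ≤ v y) (x : Rn n) :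
    cubeMaximal u x ≤ cubeMaximal v x := by
  refine cubeMaximal_le_of_forall fun a ℓ hℓ hx => ?_
  rw [mul_comm]
  exact (lintegral_mono_ae (ae_restrict_of_ae h)).trans (setLIntegral_cube_le v hℓ hx)

lemma lt_cubeMaximal_iff {u : Rn n → ℝ≥0∞} {x : Rn n} {lam : ℝ≥0∞} :
    lam < cubeMaximal u x ↔ ∃ (a : Rn n) (ℓ : ℝ), 0 < ℓ ∧ x ∈ cube a ℓ ∧
      lam * ENNReal.ofReal ℓ ^ n < ∫⁻ y in cube a ℓ, u y := by
  simp only [cubeMaximal, lt_iSup_iff, setLAverage_eq, volume_cube, exists_prop]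
  refine exists₂_congr fun a ℓ => and_congr_right fun hℓ => and_congr_right fun _ => ?_
  exact ENNReal.lt_div_iff_mul_lt (Or.inl (pow_ne_zero _ (by simpa using hℓ)))
    (Or.inl (by finiteness))

theorem mul_volume_lt_cubeMaximal_le (hn : 1 ≤ n) (u : Rn n → ℝ≥0∞) (lam : ℝ≥0∞) :
    lam * volume {x | lam < cubeMaximal u x} ≤ 5 ^ n * ∫⁻ x, u x := by
  rcases eq_or_ne lam 0 with rfl | h0
  · simp
  rcases eq_or_ne lam ∞ with rfl | htop
  · simp
  by_cases hI : ∫⁻ x, u x = ∞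
  · rw [hI, ENNReal.mul_top (by positivity)]; exact le_top
  let t : Set (Rn n × ℝ) :=
    {q | 0 < q.2 ∧ lam * ENNReal.ofReal q.2 ^ n < ∫⁻ y in cube q.1 q.2, u y}
  have hside : ∀ q ∈ t, q.2 ≤ max 1 ((∫⁻ x, u x) / lam).toReal := by
    rintro ⟨a, ℓ⟩ ⟨-, hq⟩
    refine le_max_iff.2 ((le_total ℓ 1).imp_right fun h1 => ?_)
    refine (ENNReal.ofReal_le_iff_le_toReal (ENNReal.div_ne_top hI h0)).1 ?_
    rw [ENNReal.le_div_iff_mul_le (Or.inl h0) (Or.inl htop), mul_comm]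
    refine le_trans ?_ (hq.le.trans (setLIntegral_le_lintegral _ _))
    gcongr
    exact le_self_pow₀ (by simpa using h1) (by omega)
  obtain ⟨s, hst, hsc, hdisj, hcov⟩ := exists_disjoint_cubes_covering t (fun q hq => hq.1) hside
  have hsub : {x | lam < cubeMaximal u x} ⊆
      ⋃ q ∈ s, centredCube (q.1 + WithLp.toLp 2 fun _ => q.2 / 2) (5 * (q.2 / 2)) := by
    intro x hx
    obtain ⟨a, ℓ, hℓ, hxa, hlt⟩ := lt_cubeMaximal_iff.1 hx
    obtain ⟨q, hq, hle⟩ := hcov (a, ℓ) ⟨hℓ, hlt⟩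
    exact Set.mem_biUnion hq (hle hxa)
  calc lam * volume {x | lam < cubeMaximal u x}
      ≤ lam * ∑' q : s, ENNReal.ofReal (2 * (5 * (q.1.2 / 2))) ^ n := by
        gcongr
        refine (measure_mono hsub).trans ((measure_biUnion_le volume hsc _).trans ?_)
        simp only [volume_centredCube, le_refl]
    _ = ∑' q : s, 5 ^ n * (lam * ENNReal.ofReal q.1.2 ^ n) := by
        rw [← ENNReal.tsum_mul_left]
        congr with q
        rw [show 2 * (5 * (q.1.2 / 2)) = 5 * q.1.2 by ring, ENNReal.ofReal_mul (by norm_num),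
          mul_pow, ENNReal.ofReal_ofNat]
        ring
    _ ≤ ∑' q : s, 5 ^ n * ∫⁻ y in cube q.1.1 q.1.2, u y := by
        gcongr with q
        exact (hst q.2).2.le
    _ = 5 ^ n * ∫⁻ y in ⋃ q ∈ s, cube q.1 q.2, u y := by
        rw [ENNReal.tsum_mul_left, lintegral_biUnion hsc (fun q _ => measurableSet_cube _ _) hdisj]
    _ ≤ 5 ^ n * ∫⁻ x, u x := by
        gcongr; exact Measure.restrict_le_self

lemma setLIntegral_annulus_le (u : Rn n → ℝ≥0∞) {ε r R : ℝ} (hε : 0 ≤ ε) (hr : 0 ≤ r) (hR : 0 < R)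
    {x p : Rn n} (hp : ‖p - x‖ ≤ 2 * R) :
    ∫⁻ y in {y | R ≤ ‖x - y‖ ∧ ‖x - y‖ ≤ 2 * R},
        ENNReal.ofReal (r ^ ε / ‖x - y‖ ^ (n + ε)) * u y ≤
      4 ^ n * ENNReal.ofReal ((r / R) ^ ε) * cubeMaximal u p := by
  have hmeas : Measurable fun y : Rn n => ‖x - y‖ := by fun_prop
  calc _ ≤ ∫⁻ y in {y | R ≤ ‖x - y‖ ∧ ‖x - y‖ ≤ 2 * R},
        ENNReal.ofReal (r ^ ε / R ^ (n + ε)) * u y := by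
        refine setLIntegral_mono' ((measurableSet_le measurable_const hmeas).inter
          (measurableSet_le hmeas measurable_const)) fun y hy => ?_
        have := hy.1
        gcongr
    _ = ENNReal.ofReal (r ^ ε / R ^ (n + ε)) *
        ∫⁻ y in {y | R ≤ ‖x - y‖ ∧ ‖x - y‖ ≤ 2 * R}, u y :=
        lintegral_const_mul' _ _ ENNReal.ofReal_ne_top
    _ ≤ ENNReal.ofReal (r ^ ε / R ^ (n + ε)) *
        (ENNReal.ofReal (2 * (2 * R)) ^ n * cubeMaximal u p) := by
        gcongr
        refine (lintegral_mono_set fun y hy => ?_).trans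
          (setLIntegral_closedBall_le u (c := x) (by positivity) hp)
        exact mem_closedBall_iff_norm'.2 hy.2
    _ = _ := by
        rw [← mul_assoc, ← ENNReal.ofReal_pow (by positivity), ← ENNReal.ofReal_mul (by positivity),
          Real.rpow_add hR, Real.rpow_natCast, Real.div_rpow hr hR.le,
          show (4 : ℝ≥0∞) ^ n = ENNReal.ofReal (4 ^ n) by simp [ENNReal.ofReal_pow],
          ← ENNReal.ofReal_mul (by positivity)]
        congr 2
        have : 0 < R ^ ε := by positivity
        rw [show 2 * (2 * R) = 4 * R by ring, mul_pow]
        field_simp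

/-- The constant in `setLIntegral_decay_le`: `4 ^ n` times the sum of the geometric series with
ratio `2 ^ (-ε)`. -/
noncomputable def decayConst (n : ℕ) (ε : ℝ) : ℝ≥0 :=
  4 ^ n * (1 - 2 ^ (-ε))⁻¹

theorem setLIntegral_decay_le (u : Rn n → ℝ≥0∞) {ε r : ℝ} (hε : 0 < ε) (hr : 0 < r)
    {x p : Rn n} (hp : ‖p - x‖ ≤ r) :
    ∫⁻ y in {y | r < ‖x - y‖}, ENNReal.ofReal (r ^ ε / ‖x - y‖ ^ (n + ε)) * u y ≤
      decayConst n ε * cubeMaximal u p := by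
  have hsub : {y : Rn n | r < ‖x - y‖} ⊆
      ⋃ k : ℕ, {y | 2 ^ k * r ≤ ‖x - y‖ ∧ ‖x - y‖ ≤ 2 * (2 ^ k * r)} := by
    intro y hy
    obtain ⟨k, hk₁, hk₂⟩ := exists_nat_pow_near ((one_le_div hr).2 (le_of_lt hy)) one_lt_two
    rw [le_div_iff₀ hr] at hk₁
    rw [div_lt_iff₀ hr, pow_succ', mul_assoc] at hk₂
    exact Set.mem_iUnion.2 ⟨k, hk₁, hk₂.le⟩
  have hratio (k : ℕ) : ENNReal.ofReal ((r / (2 ^ k * r)) ^ ε) = ((2 : ℝ≥0) ^ (-ε) : ℝ≥0) ^ k := by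
    rw [div_mul_cancel_right₀ hr.ne', ← ENNReal.coe_pow, ← NNReal.rpow_natCast, ← NNReal.rpow_mul,
      ← ENNReal.ofReal_coe_nnreal, NNReal.coe_rpow, Real.inv_rpow (by positivity),
      ← Real.rpow_neg (by positivity), ← Real.rpow_natCast, ← Real.rpow_mul (by positivity)]
    congr 2
    ring
  have hlt : (2 : ℝ≥0) ^ (-ε) < 1 := NNReal.rpow_lt_one_of_one_lt_of_neg one_lt_two (by linarith)
  calc _ ≤ _ := lintegral_mono_set hsub
    _ ≤ _ := lintegral_iUnion_le _ _
    _ ≤ ∑' k : ℕ, 4 ^ n * ((2 : ℝ≥0) ^ (-ε) : ℝ≥0) ^ k * cubeMaximal u p := by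
      refine ENNReal.tsum_le_tsum fun k => ?_
      rw [← hratio k]
      refine setLIntegral_annulus_le u hε.le hr.le (by positivity) (hp.trans ?_)
      nlinarith [one_le_pow₀ (one_le_two (α := ℝ)) (n := k)]
    _ = _ := by
      rw [ENNReal.tsum_mul_right, ENNReal.tsum_mul_left, ENNReal.tsum_geometric, decayConst,
        ENNReal.coe_mul, ENNReal.coe_inv (tsub_pos_of_lt hlt).ne', ENNReal.coe_sub]
      simp

end MaximalFunction

section StoppingCubes

variable {n : ℕ}

lemma volume_ocube (a : Rn n) (ℓ : ℝ) : volume (ocube a ℓ) = ENNReal.ofReal ℓ ^ n := by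
  rw [ocube_eq_preimage, (PiLp.volume_preserving_ofLp (Fin n)).measure_preimage
    (MeasurableSet.univ_pi fun _ => measurableSet_Ico).nullMeasurableSet]
  simp [volume_pi_pi]

lemma ocube_ae_eq_cube (a : Rn n) (ℓ : ℝ) : ocube a ℓ =ᵐ[volume] cube a ℓ :=
  ae_eq_of_subset_of_measure_ge (ocube_subset_cube a ℓ) (by rw [volume_cube, volume_ocube])
    (measurableSet_ocube a ℓ).nullMeasurableSet (by rw [volume_cube]; finiteness)

theorem ae_tendsto_cube_average {u : Rn n → ℝ≥0∞} (hu : AEMeasurable u volume)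
    (hfin : ∫⁻ x, u x ≠ ∞) :
    ∀ᵐ x, ∀ (a : ℕ → Rn n) (ℓ : ℕ → ℝ), (∀ k, 0 < ℓ k) →
      Filter.Tendsto ℓ Filter.atTop (nhds 0) → (∀ k, x ∈ cube (a k) (ℓ k)) →
      Filter.Tendsto (fun k => (∫⁻ y in cube (a k) (ℓ k), u y) / ENNReal.ofReal (ℓ k) ^ n)
        Filter.atTop (nhds (u x)) := by
  have hto := PiLp.volume_preserving_toLp (Fin n)
  have hof := PiLp.volume_preserving_ofLp (Fin n)
  have hemb : MeasurableEmbedding (WithLp.ofLp : Rn n → Fin n → ℝ) :=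
    (MeasurableEquiv.toLp 2 (Fin n → ℝ)).symm.measurableEmbedding
  have hfin' : ∫⁻ y : Fin n → ℝ, u (WithLp.toLp 2 y) ≠ ∞ := by
    rwa [hto.lintegral_comp_emb (MeasurableEquiv.toLp 2 (Fin n → ℝ)).measurableEmbedding]
  have hdiff := (IsUnifLocDoublingMeasure.vitaliFamily (volume : Measure (Fin n → ℝ))
    1).ae_tendsto_lintegral_div (hu.comp_quasiMeasurePreserving hto.quasiMeasurePreserving) hfin'
  filter_upwards [hof.quasiMeasurePreserving.ae hdiff] with x hx a ℓ hpos hlim hmem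
  have hcube (k : ℕ) : cube (a k) (ℓ k) = WithLp.ofLp ⁻¹'
      Metric.closedBall (a k + WithLp.toLp 2 fun _ => ℓ k / 2).ofLp (ℓ k / 2) := by
    rw [cube_eq_centredCube, centredCube_eq_preimage_closedBall _ (half_pos (hpos k)).le]
  refine (hx.comp (IsUnifLocDoublingMeasure.tendsto_closedBall_filterAt volume
    (fun k => (a k + WithLp.toLp 2 fun _ => ℓ k / 2).ofLp) (fun k => ℓ k / 2)
    (tendsto_nhdsWithin_iff.2 ⟨by simpa using hlim.div_const 2,
      .of_forall fun k => half_pos (hpos k)⟩) (.of_forall fun k => ?_))).congr fun k => ?_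
  · rw [one_mul]
    have := hmem k
    rwa [hcube] at this
  · rw [← volume_cube (a k), hcube, Function.comp_apply,
      hof.measure_preimage measurableSet_closedBall.nullMeasurableSet,
      ← hof.setLIntegral_comp_preimage_emb hemb]
    rfl

/-- The index of the dyadic cube of side `ℓ / 2 ^ k` containing `x`. -/
noncomputable def dyadicIndex (ℓ : ℝ) (k : ℕ) (x : Rn n) : Fin n → ℤ :=
  fun i => ⌊x i / (ℓ / 2 ^ k)⌋

/-- The half-open dyadic cube of generation `p.1`, that is, of side `ℓ / 2 ^ p.1`, and index
`p.2`. -/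
def dyadicCube (ℓ : ℝ) (p : ℕ × (Fin n → ℤ)) : Set (Rn n) :=
  ocube (WithLp.toLp 2 fun i => ℓ / 2 ^ p.1 * p.2 i) (ℓ / 2 ^ p.1)

lemma mem_dyadicCube {ℓ : ℝ} (hℓ : 0 < ℓ) {p : ℕ × (Fin n → ℤ)} {x : Rn n} :
    x ∈ dyadicCube ℓ p ↔ dyadicIndex ℓ p.1 x = p.2 := by
  have hs : 0 < ℓ / 2 ^ p.1 := by positivity
  rw [funext_iff]
  refine forall_congr' fun i => ?_
  rw [dyadicIndex, Int.floor_eq_iff, le_div_iff₀ hs, div_lt_iff₀ hs, Set.mem_Ico, add_one_mul,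
    mul_comm (p.2 i : ℝ)]

lemma dyadicIndex_eq_ediv (ℓ : ℝ) {j k : ℕ} (hjk : j ≤ k) (x : Rn n) (i : Fin n) :
    dyadicIndex ℓ j x i = dyadicIndex ℓ k x i / (2 ^ (k - j) : ℕ) := by
  obtain ⟨d, rfl⟩ := Nat.exists_eq_add_of_le hjk
  rw [dyadicIndex, dyadicIndex, ← Int.floor_div_natCast, div_div, Nat.add_sub_cancel_left, pow_add]
  push_cast
  field_simp

lemma dyadicIndex_eq_of_mem_dyadicCube {ℓ : ℝ} (hℓ : 0 < ℓ) {p : ℕ × (Fin n → ℤ)} {x y : Rn n}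
    (hx : x ∈ dyadicCube ℓ p) (hy : y ∈ dyadicCube ℓ p) {j : ℕ} (hj : j ≤ p.1) :
    dyadicIndex ℓ j x = dyadicIndex ℓ j y := by
  funext i
  rw [dyadicIndex_eq_ediv ℓ hj, dyadicIndex_eq_ediv ℓ hj, (mem_dyadicCube hℓ).1 hx,
    (mem_dyadicCube hℓ).1 hy]

/-- The cubes of a family `H` of dyadic cubes that lie in no strictly larger cube of `H`. -/
def maximalDyadic (ℓ : ℝ) (H : Set (ℕ × (Fin n → ℤ))) : Set (ℕ × (Fin n → ℤ)) :=
  {p ∈ H | ∀ x ∈ dyadicCube ℓ p, ∀ j < p.1, (j, dyadicIndex ℓ j x) ∉ H}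

lemma pairwiseDisjoint_maximalDyadic {ℓ : ℝ} (hℓ : 0 < ℓ) (H : Set (ℕ × (Fin n → ℤ))) :
    (maximalDyadic ℓ H).PairwiseDisjoint (dyadicCube ℓ) := by
  rintro ⟨k, m⟩ ⟨hH, hmax⟩ ⟨k', m'⟩ ⟨hH', hmax'⟩ hne
  refine Set.disjoint_left.2 fun x hx hx' => hne ?_
  obtain rfl : dyadicIndex ℓ k x = m := (mem_dyadicCube hℓ).1 hx
  obtain rfl : dyadicIndex ℓ k' x = m' := (mem_dyadicCube hℓ).1 hx'
  rcases lt_trichotomy k k' with h | rfl | h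
  · exact absurd hH (hmax' x hx' k h)
  · rfl
  · exact absurd hH' (hmax x hx k' h)

lemma exists_mem_maximalDyadic {ℓ : ℝ} (hℓ : 0 < ℓ) {H : Set (ℕ × (Fin n → ℤ))} {x : Rn n}
    (hx : ∃ k, (k, dyadicIndex ℓ k x) ∈ H) : ∃ p ∈ maximalDyadic ℓ H, x ∈ dyadicCube ℓ p := by
  classical
  have hmem : x ∈ dyadicCube ℓ (Nat.find hx, dyadicIndex ℓ (Nat.find hx) x) :=
    (mem_dyadicCube hℓ).2 rfl
  refine ⟨_, ⟨Nat.find_spec hx, fun y hy j hj => ?_⟩, hmem⟩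
  rw [dyadicIndex_eq_of_mem_dyadicCube hℓ hy hmem hj.le]
  exact Nat.find_min hx hj

/-- The half-open cubes with corners `a i` and sides `r i` are disjoint, the average of `u` over
each of them lies in `(lam, 2 ^ n * lam]`, and `u ≤ lam` almost everywhere off their union: the
Calderón-Zygmund stopping cubes of `u` at height `lam`. -/
structure IsStoppingFamily (u : Rn n → ℝ≥0∞) (lam : ℝ≥0∞) {ι : Type} (a : ι → Rn n)
    (r : ι → ℝ) : Prop where
  side_pos : ∀ i, 0 < r i
  disjoint : Pairwise fun i j => Disjoint (ocube (a i) (r i)) (ocube (a j) (r j))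
  lt_setLIntegral : ∀ i, lam * ENNReal.ofReal (r i) ^ n < ∫⁻ y in ocube (a i) (r i), u y
  setLIntegral_le : ∀ i,
    ∫⁻ y in ocube (a i) (r i), u y ≤ 2 ^ n * (lam * ENNReal.ofReal (r i) ^ n)
  ae_le : ∀ᵐ x, (∀ i, x ∉ ocube (a i) (r i)) → u x ≤ lam

lemma IsStoppingFamily.mul_tsum_le {u : Rn n → ℝ≥0∞} {lam : ℝ≥0∞} {ι : Type} [Countable ι]
    {a : ι → Rn n} {r : ι → ℝ} (h : IsStoppingFamily u lam a r) :
    lam * ∑' i, ENNReal.ofReal (r i) ^ n ≤ ∫⁻ x, u x :=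
  calc lam * ∑' i, ENNReal.ofReal (r i) ^ n
      = ∑' i, lam * ENNReal.ofReal (r i) ^ n := ENNReal.tsum_mul_left.symm
    _ ≤ ∑' i, ∫⁻ y in ocube (a i) (r i), u y :=
        ENNReal.tsum_le_tsum fun i => (h.lt_setLIntegral i).le
    _ = ∫⁻ y in ⋃ i, ocube (a i) (r i), u y :=
        (lintegral_iUnion (fun _ => measurableSet_ocube _ _) h.disjoint _).symm
    _ ≤ ∫⁻ x, u x := setLIntegral_le_lintegral _ _

theorem exists_isStoppingFamily {u : Rn n → ℝ≥0∞} (hu : AEMeasurable u volume) {lam : ℝ≥0∞}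
    (htop : lam ≠ ∞) {ℓ : ℝ} (hℓ : 0 < ℓ) (hint : ∫⁻ x, u x ≤ lam * ENNReal.ofReal ℓ ^ n) :
    ∃ (ι : Type) (_ : Countable ι) (a : ι → Rn n) (r : ι → ℝ), IsStoppingFamily u lam a r := by
  let heavy : Set (ℕ × (Fin n → ℤ)) :=
    {p | lam * ENNReal.ofReal (ℓ / 2 ^ p.1) ^ n < ∫⁻ y in dyadicCube ℓ p, u y}
  have hpos (k : ℕ) : 0 < ℓ / 2 ^ k := by positivity
  refine ⟨maximalDyadic ℓ heavy, inferInstance,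
    fun p => WithLp.toLp 2 fun i => ℓ / 2 ^ p.1.1 * p.1.2 i, fun p => ℓ / 2 ^ p.1.1,
    fun p => hpos _, (pairwiseDisjoint_maximalDyadic hℓ heavy).subtype, fun p => p.2.1, ?_, ?_⟩
  · rintro ⟨⟨_ | k, m⟩, hheavy, hmax⟩
    · have hlt : lam * ENNReal.ofReal ℓ ^ n < ∫⁻ y in dyadicCube ℓ (0, m), u y := by
        simpa [heavy] using hheavy
      exact absurd hlt ((setLIntegral_le_lintegral _ _).trans hint).not_gt
    let x : Rn n := WithLp.toLp 2 fun i => ℓ / 2 ^ (k + 1) * m i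
    have hx : x ∈ dyadicCube ℓ (k + 1, m) := fun i => by simp [x, hpos (k + 1)]
    have hsub : dyadicCube ℓ (k + 1, m) ⊆ dyadicCube ℓ (k, dyadicIndex ℓ k x) := fun y hy =>
      (mem_dyadicCube hℓ).2 (dyadicIndex_eq_of_mem_dyadicCube hℓ hy hx k.le_succ)
    refine (lintegral_mono_set hsub).trans ((not_lt.1 (hmax x hx k k.lt_succ_self)).trans_eq ?_)
    have hparent : ℓ / 2 ^ k = 2 * (ℓ / 2 ^ (k + 1)) := by rw [pow_succ]; field_simp
    rw [hparent, ENNReal.ofReal_mul two_pos.le, mul_pow, ENNReal.ofReal_ofNat]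
    ring
  · have hfin : ∫⁻ x, u x ≠ ∞ := ne_top_of_le_ne_top (by finiteness) hint
    have hlim : Filter.Tendsto (fun k : ℕ => ℓ / 2 ^ k) Filter.atTop (nhds 0) :=
      tendsto_const_nhds.div_atTop (tendsto_pow_atTop_atTop_of_one_lt one_lt_two)
    filter_upwards [ae_tendsto_cube_average hu hfin] with x hx hout
    have hlight (k : ℕ) : (k, dyadicIndex ℓ k x) ∉ heavy := fun hk =>
      have ⟨p, hp, hxp⟩ := exists_mem_maximalDyadic hℓ ⟨k, hk⟩
      hout ⟨p, hp⟩ hxp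
    have hmem (k : ℕ) : x ∈ dyadicCube ℓ (k, dyadicIndex ℓ k x) := (mem_dyadicCube hℓ).2 rfl
    refine le_of_tendsto' (hx _ _ hpos hlim fun k => ocube_subset_cube _ _ (hmem k)) fun k => ?_
    rw [← setLIntegral_congr (ocube_ae_eq_cube _ _)]
    exact ENNReal.div_le_of_le_mul (not_lt.1 (hlight k))

/-- The cubes are the stopping cubes of the indicator of `E` at height `2 ^ -(n + 1)`: `E` fills at
most half of each of them. -/
lemma exists_cubes_covering_of_volume_le {E : Set (Rn n)} {ℓ : ℝ} (hℓ : 0 < ℓ)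
    (hE : 2 ^ (n + 2) * volume E ≤ ENNReal.ofReal ℓ ^ n) :
    ∃ (ι : Type) (_ : Countable ι) (a : ι → Rn n) (r : ι → ℝ), (∀ i, 0 < r i) ∧
      ∑' i, ENNReal.ofReal (r i) ^ n ≤ 2⁻¹ * ENNReal.ofReal ℓ ^ n ∧
      (∀ i, ∃ x ∈ cube (a i) (r i), x ∉ E) ∧ ∀ᵐ x, x ∈ E → ∃ i, x ∈ cube (a i) (r i) := by
  let E' := toMeasurable volume E
  have hm : MeasurableSet E' := measurableSet_toMeasurable _ _
  have hind : ∫⁻ x, E'.indicator 1 x = volume E := by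
    rw [lintegral_indicator_one hm, measure_toMeasurable]
  let θ : ℝ≥0∞ := (2 ^ (n + 1))⁻¹
  have hθ (z : ℝ≥0∞) : 2 ^ (n + 1) * (θ * z) = z := by
    rw [← mul_assoc, ENNReal.mul_inv_cancel (by simp) (by finiteness), one_mul]
  have hhalf : 2 ^ (n + 1) * volume E ≤ 2⁻¹ * ENNReal.ofReal ℓ ^ n := by
    rw [mul_comm 2⁻¹, ← div_eq_mul_inv, ENNReal.le_div_iff_mul_le (by simp) (by simp)]
    exact le_trans (le_of_eq (by ring)) hE
  have hint : ∫⁻ x, E'.indicator 1 x ≤ θ * ENNReal.ofReal ℓ ^ n := by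
    rw [hind, ← ENNReal.div_eq_inv_mul, ENNReal.le_div_iff_mul_le (by simp) (by simp), mul_comm]
    exact hhalf.trans (mul_le_of_le_one_left' (ENNReal.inv_le_one.2 one_le_two))
  obtain ⟨ι, _, a, r, hfam⟩ := exists_isStoppingFamily
    (measurable_one.indicator hm).aemeasurable (ENNReal.inv_ne_top.2 (by simp)) hℓ hint
  refine ⟨ι, inferInstance, a, r, hfam.side_pos, ?_, fun i => ?_, ?_⟩
  · rw [← hθ (∑' i, _)]
    refine le_trans ?_ hhalf
    gcongr
    exact hfam.mul_tsum_le.trans_eq hind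
  · by_contra! hsub
    have hle := hfam.setLIntegral_le i
    rw [lintegral_indicator_one hm, Measure.restrict_apply hm, Set.inter_eq_right.2 fun x hx =>
      subset_toMeasurable _ _ (hsub x (ocube_subset_cube _ _ hx)), volume_ocube] at hle
    have h0 : ENNReal.ofReal (r i) ^ n ≠ 0 := pow_ne_zero _ (by simpa using hfam.side_pos i)
    have hlt : ENNReal.ofReal (r i) ^ n < 2 * ENNReal.ofReal (r i) ^ n := by
      rw [two_mul]
      exact ENNReal.lt_add_right (by finiteness) h0
    refine hlt.not_ge ((mul_le_mul_right hle 2).trans_eq ?_)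
    rw [← mul_assoc, ← pow_succ', hθ]
  · filter_upwards [hfam.ae_le] with x hx hxE
    by_contra! hout
    have hle := hx fun i h => hout i (ocube_subset_cube _ _ h)
    rw [Set.indicator_of_mem (subset_toMeasurable _ _ hxE), Pi.one_apply] at hle
    exact hle.not_gt (ENNReal.inv_lt_one.2 (one_lt_pow₀ ENNReal.one_lt_two (by simp)))

end StoppingCubes

section StandardKernel

variable {n : ℕ} {K : Rn n → Rn n → ℂ} {A ε : ℝ}

lemma measurableSet_lt_norm_sub (x : Rn n) (δ : ℝ) : MeasurableSet {y | δ < ‖x - y‖} :=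
  measurableSet_lt measurable_const (by fun_prop)

namespace IsStandardKernel

lemma const_nonneg (hK : IsStandardKernel K A ε) {x y : Rn n} (hxy : x ≠ y) : 0 ≤ A := by
  have hpos : 0 < ‖x - y‖ ^ n := pow_pos (norm_pos_iff.2 (sub_ne_zero.2 hxy)) n
  simpa [div_mul_cancel₀ _ hpos.ne'] using
    mul_nonneg ((norm_nonneg _).trans (hK.size x y hxy)) hpos.le

lemma norm_le (hK : IsStandardKernel K A ε) {x y : Rn n} {δ : ℝ} (hδ : 0 < δ)
    (hxy : δ ≤ ‖x - y‖) : ‖K x y‖ ≤ A / δ ^ n := by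
  have hne : x ≠ y := sub_ne_zero.1 (norm_pos_iff.1 (hδ.trans_le hxy))
  have := hK.const_nonneg hne
  exact (hK.size x y hne).trans (by gcongr)

lemma continuousOn (hK : IsStandardKernel K A ε) (hε : 0 < ε) (x : Rn n) :
    ContinuousOn (K x) {x}ᶜ := by
  intro y hy
  refine ContinuousAt.continuousWithinAt ?_
  rw [ContinuousAt, tendsto_iff_norm_sub_tendsto_zero]
  have hlim : Filter.Tendsto (fun z => A * ‖y - z‖ ^ ε / ‖y - x‖ ^ (n + ε)) (nhds y) (nhds 0) := by
    have hc : ContinuousAt (fun z => A * ‖y - z‖ ^ ε / ‖y - x‖ ^ (n + ε)) y :=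
      (continuousAt_const.mul
        (ContinuousAt.rpow_const (by fun_prop) (Or.inr hε.le))).div_const _
    simpa [Real.zero_rpow hε.ne'] using hc.tendsto
  have hnear : ∀ᶠ z in nhds y, 2 * ‖y - z‖ < ‖y - x‖ := by
    have hc : ContinuousAt (fun z => 2 * ‖y - z‖) y := by fun_prop
    exact hc.eventually (gt_mem_nhds (by simpa [sub_eq_zero] using hy))
  refine squeeze_zero' (.of_forall fun _ => norm_nonneg _) ?_ hlim
  filter_upwards [hnear] with z hz
  have := hK.regularity y x z hz
  rw [norm_sub_rev]
  linarith [norm_nonneg (K y x - K z x)]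

lemma aestronglyMeasurable (hK : IsStandardKernel K A ε) (hε : 0 < ε) (x : Rn n) {s : Set (Rn n)}
    (hs : x ∉ s) : AEStronglyMeasurable (K x) (volume.restrict s) :=
  ((hK.continuousOn hε x).aestronglyMeasurable
    (measurableSet_singleton x).compl).mono_set (by simpa using hs)

lemma integrableOn (hK : IsStandardKernel K A ε) (hε : 0 < ε) (x : Rn n) {δ : ℝ} (hδ : 0 < δ)
    {F : Rn n → ℂ} (hF : Integrable F) :
    IntegrableOn (fun y => K x y * F y) {y | δ ≤ ‖x - y‖} := by
  refine Integrable.bdd_mul (c := A / δ ^ n) hF.integrableOn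
    (hK.aestronglyMeasurable hε x (by simpa using hδ)) ?_
  filter_upwards [ae_restrict_mem (measurableSet_le measurable_const (by fun_prop))] with y hy
  exact hK.norm_le hδ hy

lemma integrableOn_lt (hK : IsStandardKernel K A ε) (hε : 0 < ε) (x : Rn n) {δ : ℝ} (hδ : 0 < δ)
    {F : Rn n → ℂ} (hF : Integrable F) :
    IntegrableOn (fun y => K x y * F y) {y | δ < ‖x - y‖} :=
  (hK.integrableOn hε x hδ hF).mono_set fun y hy => by
    rw [Set.mem_ofPred_eq] at hy ⊢
    exact hy.le

lemma setLIntegral_annulus_le (hK : IsStandardKernel K A ε) {x p : Rn n} {δ : ℝ} (hδ : 0 < δ)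
    (hp : ‖p - x‖ ≤ 2 * δ) (F : Rn n → ℂ) :
    ∫⁻ y in {y | δ ≤ ‖x - y‖ ∧ ‖x - y‖ ≤ 2 * δ}, ‖K x y * F y‖ₑ ≤
      A.toNNReal * 4 ^ n * cubeMaximal (fun y => ‖F y‖ₑ) p := by
  calc _ ≤ ∫⁻ y in {y | δ ≤ ‖x - y‖ ∧ ‖x - y‖ ≤ 2 * δ},
        A.toNNReal * (ENNReal.ofReal (δ ^ (0 : ℝ) / ‖x - y‖ ^ (n + (0 : ℝ))) * ‖F y‖ₑ) := by
        have hmeas : Measurable fun y : Rn n => ‖x - y‖ := by fun_prop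
        refine setLIntegral_mono' ((measurableSet_le measurable_const hmeas).inter
          (measurableSet_le hmeas measurable_const)) fun y hy => ?_
        rw [enorm_mul, ← mul_assoc, Real.rpow_zero, add_zero, Real.rpow_natCast]
        gcongr
        change _ ≤ ENNReal.ofReal A * _
        rw [← ofReal_norm, ← ENNReal.ofReal_mul' (by positivity), mul_one_div]
        have hne : x ≠ y := sub_ne_zero.1 (norm_pos_iff.1 (hδ.trans_le hy.1))
        exact ENNReal.ofReal_le_ofReal (hK.size x y hne)
    _ ≤ _ := by
        rw [lintegral_const_mul' _ _ ENNReal.coe_ne_top, mul_assoc]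
        gcongr
        simpa using _root_.setLIntegral_annulus_le (fun y => ‖F y‖ₑ) le_rfl hδ.le hδ hp

lemma setLIntegral_sub_le (hK : IsStandardKernel K A ε) (hε : 0 < ε) {x x' p : Rn n} {δ : ℝ}
    (hδ : 0 < δ) (hx : ‖x - x'‖ ≤ δ / 3) (hp : ‖p - x‖ ≤ δ) (F : Rn n → ℂ) :
    ∫⁻ y in {y | δ < ‖x - y‖}, ‖(K x y - K x' y) * F y‖ₑ ≤
      A.toNNReal * decayConst n ε * cubeMaximal (fun y => ‖F y‖ₑ) p := by
  calc _ ≤ ∫⁻ y in {y | δ < ‖x - y‖},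
        A.toNNReal * (ENNReal.ofReal (δ ^ ε / ‖x - y‖ ^ (n + ε)) * ‖F y‖ₑ) := by
        refine setLIntegral_mono' (measurableSet_lt_norm_sub x δ) fun y hy => ?_
        rw [Set.mem_ofPred_eq] at hy
        rw [enorm_mul, ← mul_assoc]
        gcongr
        change _ ≤ ENNReal.ofReal A * _
        rw [← ofReal_norm, ← ENNReal.ofReal_mul' (by positivity)]
        refine ENNReal.ofReal_le_ofReal ?_
        have hA : 0 ≤ A :=
          hK.const_nonneg (sub_ne_zero.1 (norm_pos_iff.1 (hδ.trans hy)))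
        calc ‖K x y - K x' y‖ ≤ A * ‖x - x'‖ ^ ε / ‖x - y‖ ^ (n + ε) := by
              linarith [norm_nonneg (K y x - K y x'), hK.regularity x y x' (by linarith)]
          _ ≤ A * δ ^ ε / ‖x - y‖ ^ (n + ε) := by
              gcongr
              linarith
          _ = A * (δ ^ ε / ‖x - y‖ ^ (n + ε)) := mul_div_assoc _ _ _
    _ ≤ _ := by
        rw [lintegral_const_mul' _ _ ENNReal.coe_ne_top, mul_assoc]
        gcongr
        exact setLIntegral_decay_le _ hε hδ hp

lemma enorm_setIntegral_kernel_sub_le (hK : IsStandardKernel K A ε) (hε : 0 < ε) {x x' p : Rn n}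
    {δ : ℝ} (hδ : 0 < δ) (hx : ‖x - x'‖ ≤ δ / 3) (hp : ‖p - x‖ ≤ δ) {F : Rn n → ℂ}
    (hF : Integrable F) :
    ‖(∫ y in {y | δ < ‖x - y‖}, K x y * F y) - ∫ y in {y | δ < ‖x - y‖}, K x' y * F y‖ₑ ≤
      A.toNNReal * decayConst n ε * cubeMaximal (fun y => ‖F y‖ₑ) p := by
  have hx' : IntegrableOn (fun y => K x' y * F y) {y | δ < ‖x - y‖} := by
    refine (hK.integrableOn hε x' (δ := 2 * δ / 3) (by positivity) hF).mono_set fun y hy => ?_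
    rw [Set.mem_ofPred_eq] at hy ⊢
    linarith [norm_sub_le_norm_sub_add_norm_sub x x' y]
  rw [← integral_sub (hK.integrableOn_lt hε x hδ hF) hx']
  refine (enorm_integral_le_lintegral_enorm _).trans ?_
  simpa only [sub_mul] using hK.setLIntegral_sub_le hε hδ hx hp F

end IsStandardKernel

lemma enorm_setIntegral_sub_setIntegral_le {X E : Type*} [MeasurableSpace X] {μ : Measure X}
    [NormedAddCommGroup E] [NormedSpace ℝ E] {g : X → E} {s t : Set X} (hs : MeasurableSet s)
    (ht : MeasurableSet t) (hgs : IntegrableOn g s μ) (hgt : IntegrableOn g t μ) :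
    ‖(∫ y in s, g y ∂μ) - ∫ y in t, g y ∂μ‖ₑ ≤
      (∫⁻ y in s \ t, ‖g y‖ₑ ∂μ) + ∫⁻ y in t \ s, ‖g y‖ₑ ∂μ := by
  rw [← integral_inter_add_sdiff ht hgs, ← integral_inter_add_sdiff hs hgt, Set.inter_comm t s,
    add_sub_add_left_eq_sub]
  exact enorm_sub_le.trans
    (add_le_add (enorm_integral_le_lintegral_enorm _) (enorm_integral_le_lintegral_enorm _))

/-- The constant comparing truncated integrals at nearby points: the regularity of the kernel
accounts for the first summand, the change of the domain of integration for the second. -/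
noncomputable def shiftConst (n : ℕ) (A ε : ℝ) : ℝ≥0 :=
  A.toNNReal * decayConst n ε + 2 * (A.toNNReal * 4 ^ n)

theorem IsStandardKernel.enorm_truncatedIntegral_sub_le (hK : IsStandardKernel K A ε) (hε : 0 < ε)
    {x x' : Rn n} {δ : ℝ} (hδ : 0 < δ) (hx : ‖x - x'‖ ≤ δ / 3) {F : Rn n → ℂ}
    (hF : Integrable F) :
    ‖truncatedIntegral K δ F x - truncatedIntegral K δ F x'‖ₑ ≤
      shiftConst n A ε * cubeMaximal (fun y => ‖F y‖ₑ) x' := by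
  let M := cubeMaximal (fun y => ‖F y‖ₑ) x'
  let I (z : Rn n) : ℂ := ∫ y in {y | δ < ‖z - y‖}, K x' y * F y
  have htri (y : Rn n) : ‖x - y‖ ≤ ‖x - x'‖ + ‖x' - y‖ := norm_sub_le_norm_sub_add_norm_sub x x' y
  have htri' (y : Rn n) : ‖x' - y‖ ≤ ‖x - x'‖ + ‖x - y‖ := by
    simpa [norm_sub_rev x x'] using norm_sub_le_norm_sub_add_norm_sub x' x y
  have hkernel : ‖truncatedIntegral K δ F x - I x‖ₑ ≤ A.toNNReal * decayConst n ε * M :=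
    hK.enorm_setIntegral_kernel_sub_le hε hδ hx (by rw [norm_sub_rev]; linarith) hF
  have hann {s : Set (Rn n)} (hs : ∀ y ∈ s, 2 * δ / 3 ≤ ‖x' - y‖ ∧ ‖x' - y‖ ≤ 2 * (2 * δ / 3)) :
      ∫⁻ y in s, ‖K x' y * F y‖ₑ ≤ A.toNNReal * 4 ^ n * M :=
    (lintegral_mono_set hs).trans
      (hK.setLIntegral_annulus_le (by positivity) (by rw [sub_self, norm_zero]; positivity) F)
  have hdomain : ‖I x - I x'‖ₑ ≤ A.toNNReal * 4 ^ n * M + A.toNNReal * 4 ^ n * M := by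
    refine (enorm_setIntegral_sub_setIntegral_le (measurableSet_lt_norm_sub x δ)
      (measurableSet_lt_norm_sub x' δ) ?_ (hK.integrableOn_lt hε x' hδ hF)).trans
      (add_le_add (hann fun y hy => ?_) (hann fun y hy => ?_))
    · refine (hK.integrableOn hε x' (δ := 2 * δ / 3) (by positivity) hF).mono_set fun y hy => ?_
      rw [Set.mem_ofPred_eq] at hy ⊢
      linarith [htri y]
    all_goals
      simp only [Set.mem_sdiff, Set.mem_ofPred_eq, not_lt] at hy
      constructor <;> linarith [htri y, htri' y]
  calc ‖truncatedIntegral K δ F x - truncatedIntegral K δ F x'‖ₑ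
      = ‖(truncatedIntegral K δ F x - I x) + (I x - I x')‖ₑ := by rw [sub_add_sub_cancel]; rfl
    _ ≤ _ := (enorm_add_le _ _).trans (add_le_add hkernel hdomain)
    _ = _ := by rw [shiftConst]; push_cast; ring

lemma enorm_truncatedIntegral_le (K : Rn n → Rn n → ℂ) {δ : ℝ} (hδ : 0 < δ) (F : Rn n → ℂ)
    (x : Rn n) : ‖truncatedIntegral K δ F x‖ₑ ≤ maximalSingularIntegral K F x :=
  le_iSup_of_le δ (le_iSup_of_le hδ le_rfl)

lemma truncatedIntegral_congr_ae {F G : Rn n → ℂ} (h : F =ᵐ[volume] G) (δ : ℝ) (x : Rn n) :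
    truncatedIntegral K δ F x = truncatedIntegral K δ G x :=
  integral_congr_ae (ae_restrict_of_ae (h.mono fun y hy => by simp only [hy]))

lemma truncatedIntegral_indicator {s : Set (Rn n)} (hs : MeasurableSet s) (δ : ℝ) (F : Rn n → ℂ)
    (x : Rn n) :
    truncatedIntegral K δ (s.indicator F) x = ∫ y in {y | δ < ‖x - y‖} ∩ s, K x y * F y := by
  simp only [truncatedIntegral, ← Set.indicator_mul_right]
  exact setIntegral_indicator hs

lemma maximalSingularIntegral_congr_ae {F G : Rn n → ℂ} (h : F =ᵐ[volume] G) (x : Rn n) :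
    maximalSingularIntegral K F x = maximalSingularIntegral K G x :=
  iSup_congr fun δ => iSup_congr fun _ => by rw [truncatedIntegral_congr_ae h]

lemma IsStandardKernel.truncatedIntegral_add (hK : IsStandardKernel K A ε) (hε : 0 < ε) {δ : ℝ}
    (hδ : 0 < δ) {F G : Rn n → ℂ} (hF : Integrable F) (hG : Integrable G) (x : Rn n) :
    truncatedIntegral K δ (F + G) x = truncatedIntegral K δ F x + truncatedIntegral K δ G x := by
  simp only [truncatedIntegral, Pi.add_apply, mul_add]
  exact integral_add (hK.integrableOn_lt hε x hδ hF) (hK.integrableOn_lt hε x hδ hG)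

lemma IsStandardKernel.maximalSingularIntegral_add_le (hK : IsStandardKernel K A ε) (hε : 0 < ε)
    {F G : Rn n → ℂ} (hF : Integrable F) (hG : Integrable G) (x : Rn n) :
    maximalSingularIntegral K (F + G) x ≤
      maximalSingularIntegral K F x + maximalSingularIntegral K G x := by
  refine iSup_le fun δ => iSup_le fun hδ => ?_
  rw [hK.truncatedIntegral_add hε hδ hF hG]
  exact (enorm_add_le _ _).trans
    (add_le_add (enorm_truncatedIntegral_le K hδ F x) (enorm_truncatedIntegral_le K hδ G x))

/-- A ball containing `cube a ℓ` and so large that the points outside it are at distance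
comparable with their distance to `a` from every point of the cube: its radius is four times the
upper bound `n * ℓ` for the diameter of the cube. -/
def enlargedBall (a : Rn n) (ℓ : ℝ) : Set (Rn n) :=
  Metric.closedBall a (4 * (n * ℓ))

lemma measurableSet_enlargedBall (a : Rn n) (ℓ : ℝ) : MeasurableSet (enlargedBall a ℓ) :=
  measurableSet_closedBall

lemma norm_corner_sub_le_of_mem_cube {a x : Rn n} {ℓ : ℝ} (hℓ : 0 < ℓ) (hx : x ∈ cube a ℓ) :
    ‖a - x‖ ≤ n * ℓ :=
  norm_sub_le_of_mem_cube (fun _ => ⟨le_rfl, by linarith⟩) hx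

lemma lt_norm_sub_of_notMem_enlargedBall {a x y : Rn n} {ℓ : ℝ} (hℓ : 0 < ℓ) (hx : x ∈ cube a ℓ)
    (hy : y ∉ enlargedBall a ℓ) : 3 * (n * ℓ) < ‖x - y‖ := by
  rw [enlargedBall, mem_closedBall_iff_norm', not_le] at hy
  linarith [norm_sub_le_norm_sub_add_norm_sub a x y, norm_corner_sub_le_of_mem_cube hℓ hx]

lemma norm_sub_le_of_mem_enlargedBall {a x y : Rn n} {ℓ : ℝ} (hℓ : 0 < ℓ) (hx : x ∈ cube a ℓ)
    (hy : y ∈ enlargedBall a ℓ) : ‖x - y‖ ≤ 5 * (n * ℓ) := by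
  have hya : ‖a - y‖ ≤ 4 * (n * ℓ) := mem_closedBall_iff_norm'.1 hy
  have hxa := norm_corner_sub_le_of_mem_cube hℓ hx
  rw [norm_sub_rev] at hxa
  linarith [norm_sub_le_norm_sub_add_norm_sub x a y]

lemma cube_subset_enlargedBall (a : Rn n) {ℓ : ℝ} (hℓ : 0 < ℓ) : cube a ℓ ⊆ enlargedBall a ℓ := by
  intro x hx
  refine mem_closedBall_iff_norm'.2 ((norm_corner_sub_le_of_mem_cube hℓ hx).trans ?_)
  have : 0 ≤ n * ℓ := by positivity
  linarith

lemma ofReal_two_mul_four_mul_pow (n : ℕ) (ℓ : ℝ) :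
    ENNReal.ofReal (2 * (4 * (n * ℓ))) ^ n = (8 * n) ^ n * ENNReal.ofReal ℓ ^ n := by
  rw [show 2 * (4 * (n * ℓ)) = (8 * n : ℕ) * ℓ by push_cast; ring,
    ENNReal.ofReal_mul (by positivity), ENNReal.ofReal_natCast, mul_pow]
  push_cast
  rfl

lemma volume_enlargedBall_le (a : Rn n) (ℓ : ℝ) :
    volume (enlargedBall a ℓ) ≤ (8 * n) ^ n * ENNReal.ofReal ℓ ^ n :=
  (measure_mono (closedBall_subset_centredCube _ _)).trans_eq
    ((volume_centredCube _ _).trans (ofReal_two_mul_four_mul_pow n ℓ))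

lemma lintegral_le_mul_cubeMaximal (hn : 1 ≤ n) {u : Rn n → ℝ≥0∞} {a x : Rn n} {ℓ : ℝ}
    (hℓ : 0 < ℓ) (hsupp : ∀ y, y ∉ enlargedBall a ℓ → u y = 0) (hx : x ∈ cube a ℓ) :
    ∫⁻ y, u y ≤ (8 * n) ^ n * ENNReal.ofReal ℓ ^ n * cubeMaximal u x := by
  rw [← setLIntegral_eq_of_support_subset (s := enlargedBall a ℓ) fun y hy => ?_,
    ← ofReal_two_mul_four_mul_pow]
  · exact setLIntegral_closedBall_le u (by positivity)
      (mem_closedBall_iff_norm.1 (cube_subset_enlargedBall a hℓ hx))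
  · by_contra hyB
    exact hy (hsupp y hyB)

lemma IsStandardKernel.enorm_truncatedIntegral_compl_enlargedBall_sub_le
    (hK : IsStandardKernel K A ε) (hε : 0 < ε) (hn : 1 ≤ n) {a x x' : Rn n} {ℓ : ℝ} (hℓ : 0 < ℓ)
    (hx : x ∈ cube a ℓ) (hx' : x' ∈ cube a ℓ) {F : Rn n → ℂ} (hF : Integrable F) (δ : ℝ) :
    ‖truncatedIntegral K δ ((enlargedBall a ℓ)ᶜ.indicator F) x -
        truncatedIntegral K (max δ (3 * (n * ℓ))) F x‖ₑ ≤
      A.toNNReal * 4 ^ n * cubeMaximal (fun y => ‖F y‖ₑ) x' := by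
  have hD : 0 < 3 * (n * ℓ) := by positivity
  let s : Set (Rn n) := {y | max δ (3 * (n * ℓ)) < ‖x - y‖}
  have hs : MeasurableSet s := measurableSet_lt_norm_sub x _
  have hP : MeasurableSet (enlargedBall a ℓ)ᶜ := (measurableSet_enlargedBall a ℓ).compl
  have hset : {y | δ < ‖x - y‖} ∩ (enlargedBall a ℓ)ᶜ = s ∩ (enlargedBall a ℓ)ᶜ := by
    ext y
    simp only [s, Set.mem_inter_iff, Set.mem_ofPred_eq, max_lt_iff]
    exact ⟨fun h => ⟨⟨h.1, lt_norm_sub_of_notMem_enlargedBall hℓ hx h.2⟩, h.2⟩,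
      fun h => ⟨h.1.1, h.2⟩⟩
  have hint : IntegrableOn (fun y => K x y * F y) s :=
    hK.integrableOn_lt hε x (lt_max_of_lt_right hD) hF
  rw [truncatedIntegral_indicator hP, hset]
  refine (enorm_setIntegral_sub_setIntegral_le (hs.inter hP) hs
    (hint.mono_set Set.inter_subset_left) hint).trans ?_
  rw [Set.sdiff_eq_empty.2 Set.inter_subset_left, setLIntegral_empty, zero_add]
  refine (lintegral_mono_set fun y hy => ?_).trans (hK.setLIntegral_annulus_le hD ?_ F)
  · have hyP : y ∈ enlargedBall a ℓ := by
      by_contra h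
      exact hy.2 ⟨hy.1, h⟩
    exact ⟨((le_max_right _ _).trans_lt hy.1).le,
      by linarith [norm_sub_le_of_mem_enlargedBall hℓ hx hyP]⟩
  · linarith [norm_sub_le_of_mem_cube hx' hx]

/-- The constant in `IsStandardKernel.maximalSingularIntegral_compl_enlargedBall_le`. -/
noncomputable def farConst (n : ℕ) (A ε : ℝ) : ℝ≥0 :=
  A.toNNReal * 4 ^ n + shiftConst n A ε

theorem IsStandardKernel.maximalSingularIntegral_compl_enlargedBall_le
    (hK : IsStandardKernel K A ε) (hε : 0 < ε) (hn : 1 ≤ n) {a x x' : Rn n} {ℓ : ℝ} (hℓ : 0 < ℓ)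
    (hx : x ∈ cube a ℓ) (hx' : x' ∈ cube a ℓ) {F : Rn n → ℂ} (hF : Integrable F) :
    maximalSingularIntegral K ((enlargedBall a ℓ)ᶜ.indicator F) x ≤
      maximalSingularIntegral K F x' + farConst n A ε * cubeMaximal (fun y => ‖F y‖ₑ) x' := by
  refine iSup_le fun δ => iSup_le fun hδ => ?_
  have hδ' : 0 < max δ (3 * (n * ℓ)) := lt_max_of_lt_left hδ
  have hnear : ‖x - x'‖ ≤ max δ (3 * (n * ℓ)) / 3 := by
    linarith [le_max_right δ (3 * (n * ℓ)), norm_sub_le_of_mem_cube hx hx']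
  calc ‖truncatedIntegral K δ ((enlargedBall a ℓ)ᶜ.indicator F) x‖ₑ
      = ‖truncatedIntegral K (max δ (3 * (n * ℓ))) F x' +
        ((truncatedIntegral K δ ((enlargedBall a ℓ)ᶜ.indicator F) x -
          truncatedIntegral K (max δ (3 * (n * ℓ))) F x) +
        (truncatedIntegral K (max δ (3 * (n * ℓ))) F x -
          truncatedIntegral K (max δ (3 * (n * ℓ))) F x'))‖ₑ := by congr 1; ring
    _ ≤ _ := (enorm_add_le _ _).trans (add_le_add (enorm_truncatedIntegral_le K hδ' F x')
        ((enorm_add_le _ _).trans (add_le_add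
          (hK.enorm_truncatedIntegral_compl_enlargedBall_sub_le hε hn hℓ hx hx' hF δ)
          (hK.enorm_truncatedIntegral_sub_le hε hδ' hnear hF))))
    _ = _ := by rw [farConst]; push_cast; ring

end StandardKernel

section Representation

/-- The Hilbert space `L²(ℝⁿ)` of complex-valued functions. -/
abbrev L2Rn (n : ℕ) : Type := Lp ℂ 2 (volume : Measure (Rn n))

/-- `S` is an operator on `L²(ℝⁿ)` of norm at most `B`, associated with the standard kernel `K`. In
contrast to `IsCalderonZygmund`, the representation by the kernel is required near every ball on
which a function in `L²`, not necessarily smooth or compactly supported, vanishes. -/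
structure IsL2SingularIntegral {n : ℕ} (S : L2Rn n →L[ℂ] L2Rn n) (K : Rn n → Rn n → ℂ)
    (A ε B : ℝ) : Prop where
  kernel : IsStandardKernel K A ε
  norm_le : ‖S‖ ≤ B
  representation : ∀ (g : L2Rn n) (x : Rn n) (δ : ℝ), 0 < δ →
    (∀ᵐ y, y ∈ Metric.ball x δ → g y = 0) →
    ∀ᵐ z, z ∈ Metric.ball x (δ / 2) → S g z = ∫ y, K z y * g y

lemma tendsto_integral_mul_of_tendsto_eLpNorm {X ι : Type*} [MeasurableSpace X] {μ : Measure X}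
    {l : Filter ι} {k h : X → ℂ} {u : ι → X → ℂ} (hk : MemLp k 2 μ) (hu : ∀ j, MemLp (u j) 2 μ)
    (hh : MemLp h 2 μ) (hlim : Filter.Tendsto (fun j => eLpNorm (u j - h) 2 μ) l (nhds 0)) :
    Filter.Tendsto (fun j => ∫ y, k y * u j y ∂μ) l (nhds (∫ y, k y * h y ∂μ)) := by
  refine tendsto_integral_of_L1' _ (hk.integrable_mul hh).1
    (.of_forall fun j => hk.integrable_mul (hu j)) ?_
  have hprod : Filter.Tendsto (fun j => eLpNorm k 2 μ * eLpNorm (u j - h) 2 μ) l (nhds 0) := by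
    simpa using ENNReal.Tendsto.const_mul hlim (Or.inr hk.eLpNorm_ne_top)
  refine tendsto_of_tendsto_of_tendsto_of_le_of_le tendsto_const_nhds hprod (fun _ => zero_le)
    fun j => ?_
  have hsub : (fun y => k y * u j y) - k * h = k • (u j - h) :=
    funext fun y => (mul_sub (k y) (u j y) (h y)).symm
  rw [hsub]
  exact eLpNorm_smul_le_mul_eLpNorm (p := 2) (q := 2) (r := 1) ((hu j).1.sub hh.1) hk.1

variable {n : ℕ} {K : Rn n → Rn n → ℂ} {A ε B : ℝ}

lemma IsStandardKernel.memLp_two (hK : IsStandardKernel K A ε) (hε : 0 < ε) (hn : 1 ≤ n)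
    (x : Rn n) {δ : ℝ} (hδ : 0 < δ) : MemLp (K x) 2 (volume.restrict {y | δ < ‖x - y‖}) := by
  refine ⟨hK.aestronglyMeasurable hε x (by simpa using hδ.le),
    (eLpNorm_lt_top_iff_lintegral_rpow_enorm_lt_top two_ne_zero ENNReal.ofNat_ne_top).2 ?_⟩
  have hn' : (0 : ℝ) < n := by exact_mod_cast hn
  calc ∫⁻ y in {y | δ < ‖x - y‖}, ‖K x y‖ₑ ^ (2 : ℝ≥0∞).toReal
      ≤ ∫⁻ y in {y | δ < ‖x - y‖}, ENNReal.ofReal (A ^ 2 / δ ^ n) *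
          (ENNReal.ofReal (δ ^ (n : ℝ) / ‖x - y‖ ^ (n + n : ℝ)) * 1) := by
        refine setLIntegral_mono' (measurableSet_lt_norm_sub x δ) fun y hy => ?_
        rw [Set.mem_ofPred_eq] at hy
        have hpos : 0 < ‖x - y‖ := hδ.trans hy
        rw [mul_one, ← ENNReal.ofReal_mul (by positivity), ENNReal.toReal_ofNat,
          ENNReal.rpow_two, ← ofReal_norm, ← ENNReal.ofReal_pow (norm_nonneg _)]
        refine ENNReal.ofReal_le_ofReal ?_
        calc ‖K x y‖ ^ 2 ≤ (A / ‖x - y‖ ^ n) ^ 2 := by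
              gcongr
              exact hK.size x y (sub_ne_zero.1 (norm_pos_iff.1 hpos))
          _ = A ^ 2 / δ ^ n * (δ ^ (n : ℝ) / ‖x - y‖ ^ (n + n : ℝ)) := by
              rw [Real.rpow_add hpos, Real.rpow_natCast, Real.rpow_natCast]
              field_simp
    _ ≤ ENNReal.ofReal (A ^ 2 / δ ^ n) * (decayConst n n * cubeMaximal (fun _ => 1) x) := by
        rw [lintegral_const_mul' _ _ ENNReal.ofReal_ne_top]
        gcongr
        exact setLIntegral_decay_le _ hn' hδ (by simpa using hδ.le)
    _ ≤ ENNReal.ofReal (A ^ 2 / δ ^ n) * (decayConst n n * 1) := by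
        gcongr
        exact cubeMaximal_le_of_ae_le (.of_forall fun _ => le_rfl) x
    _ < ∞ := by finiteness

lemma exists_smoothCc_eLpNorm_sub_le {g : Rn n → ℂ} (hg : MemLp g 2) {x : Rn n} {δ η : ℝ}
    (hδ : 0 < δ) (hη : 0 < η) (hg0 : ∀ᵐ y, y ∈ Metric.ball x δ → g y = 0) :
    ∃ φ : SmoothCc n, (∀ y ∈ Metric.ball x (3 * δ / 4), φ y = 0) ∧
      eLpNorm (⇑φ - g) 2 volume ≤ ENNReal.ofReal η := by
  obtain ⟨ψ, hψs, hψc, hψ⟩ := hg.exist_eLpNorm_sub_le ENNReal.ofNat_ne_top one_le_two hη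
  let b : ContDiffBump x := ⟨3 * δ / 4, δ, by positivity, by linarith⟩
  have hb : ContDiff ℝ (⊤ : ℕ∞) fun y => ((1 - b y : ℝ) : ℂ) :=
    Complex.ofRealCLM.contDiff.comp (contDiff_const.sub b.contDiff)
  refine ⟨⟨fun y => ((1 - b y : ℝ) : ℂ) * ψ y, hb.mul hψc, hψs.mul_left, fun _ _ => trivial⟩,
    fun y hy => ?_, ?_⟩
  · change ((1 - b y : ℝ) : ℂ) * ψ y = 0
    rw [b.one_of_mem_closedBall (Metric.ball_subset_closedBall hy), sub_self, Complex.ofReal_zero,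
      zero_mul]
  · rw [eLpNorm_sub_comm]
    refine (eLpNorm_mono_ae ?_).trans hψ
    filter_upwards [hg0] with y hy
    change ‖g y - ((1 - b y : ℝ) : ℂ) * ψ y‖ ≤ ‖g y - ψ y‖
    have hgb : g y = ((1 - b y : ℝ) : ℂ) * g y := by
      by_cases hyx : y ∈ Metric.ball x δ
      · rw [hy hyx, mul_zero]
      · rw [b.zero_of_le_dist (not_lt.1 hyx), sub_zero, Complex.ofReal_one, one_mul]
    calc ‖g y - ((1 - b y : ℝ) : ℂ) * ψ y‖ = |1 - b y| * ‖g y - ψ y‖ := by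
          rw [← Real.norm_eq_abs, ← Complex.norm_real, ← norm_mul, mul_sub, ← hgb]
      _ ≤ ‖g y - ψ y‖ :=
          mul_le_of_le_one_left (norm_nonneg _)
            (abs_le.2 ⟨by linarith [b.le_one (x := y)], by linarith [b.nonneg (x := y)]⟩)

lemma integral_kernel_mul_eq_setIntegral {g : Rn n → ℂ} {x z : Rn n} {δ : ℝ}
    (hz : z ∈ Metric.ball x (δ / 2)) (hg : ∀ᵐ y, y ∈ Metric.ball x (3 * δ / 4) → g y = 0) :
    ∫ y, K z y * g y = ∫ y in {y | δ / 8 < ‖z - y‖}, K z y * g y := by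
  refine (setIntegral_eq_integral_of_ae_compl_eq_zero ?_).symm
  filter_upwards [hg] with y hy hzy
  rw [not_lt] at hzy
  rw [hy ?_, mul_zero]
  rw [mem_ball_iff_norm] at hz ⊢
  have hδ : 0 ≤ δ := by linarith [norm_nonneg (z - x)]
  rw [norm_sub_rev] at hzy
  linarith [norm_sub_le_norm_sub_add_norm_sub y z x]

theorem IsCalderonZygmund.exists_isL2SingularIntegral {T : SmoothCc n →ₗ[ℂ] (Rn n →ₘ[volume] ℂ)}
    (hT : IsCalderonZygmund T K A ε B) (hε : 0 < ε) (hn : 1 ≤ n) :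
    ∃ S : L2Rn n →L[ℂ] L2Rn n, IsL2SingularIntegral S K A ε B := by
  obtain ⟨S, hSB, hST⟩ := hT.extends_L2
  refine ⟨S, hT.kernel, hSB, fun g x δ hδ hg0 => ?_⟩
  choose φ hφ0 hφg using fun k : ℕ =>
    exists_smoothCc_eLpNorm_sub_le (Lp.memLp g) hδ (Nat.one_div_pos_of_nat (α := ℝ) (n := k)) hg0
  have hφ (k : ℕ) : MemLp (φ k) 2 :=
    (φ k).contDiff.continuous.memLp_of_hasCompactSupport (φ k).hasCompactSupport
  have hlim : Filter.Tendsto (fun k => eLpNorm (⇑(φ k) - ⇑g) 2 volume) Filter.atTop (nhds 0) := by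
    refine tendsto_of_tendsto_of_tendsto_of_le_of_le tendsto_const_nhds ?_ (fun _ => zero_le) hφg
    simpa using ENNReal.tendsto_ofReal (tendsto_one_div_add_atTop_nhds_zero_nat (𝕜 := ℝ))
  have hSlim : Filter.Tendsto (fun k => S ((hφ k).toLp (φ k))) Filter.atTop (nhds (S g)) :=
    (S.continuous.tendsto _).comp
      (by simpa using (Lp.tendsto_Lp_iff_tendsto_eLpNorm'' _ hφ g (Lp.memLp g)).2 hlim)
  have hrep (k : ℕ) : ∀ᵐ z, z ∈ Metric.ball x (δ / 2) →
      S ((hφ k).toLp (φ k)) z = ∫ y, K z y * φ k y := by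
    filter_upwards [hST (φ k) _ (hφ k).coeFn_toLp, hT.representation (φ k)] with z hz₁ hz₂ hz
    rw [hz₁, hz₂ (notMem_tsupport_iff_eventuallyEq.2 ?_)]
    filter_upwards [Metric.isOpen_ball.mem_nhds hz] with y hy
    exact hφ0 k y (Metric.ball_subset_ball (by linarith) hy)
  obtain ⟨ns, hns, hae⟩ := (tendstoInMeasure_of_tendsto_Lp hSlim).exists_seq_tendsto_ae
  filter_upwards [hae, ae_all_iff.2 hrep] with z hz hz' hzx
  have hint : Filter.Tendsto (fun k => ∫ y, K z y * φ k y) Filter.atTop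
      (nhds (∫ y, K z y * g y)) := by
    rw [integral_kernel_mul_eq_setIntegral hzx (hg0.mono fun y hy hyx =>
      hy (Metric.ball_subset_ball (by linarith) hyx))]
    simp_rw [fun k => integral_kernel_mul_eq_setIntegral (K := K) hzx (.of_forall (hφ0 k))]
    refine tendsto_integral_mul_of_tendsto_eLpNorm (hT.kernel.memLp_two hε hn z (by positivity))
      (fun k => (hφ k).restrict _) ((Lp.memLp g).restrict _)
      (tendsto_of_tendsto_of_tendsto_of_le_of_le tendsto_const_nhds hlim (fun _ => zero_le)
        fun k => eLpNorm_mono_measure _ Measure.restrict_le_self)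
  exact tendsto_nhds_unique hz
    ((hint.comp hns.tendsto_atTop).congr fun k => (hz' (ns k) hzx).symm)

end Representation

section Cotlar

/-- The maximal function of the quadratic means of `u` over cubes. -/
noncomputable def cubeMaximalTwo {n : ℕ} (u : Rn n → ℝ≥0∞) (x : Rn n) : ℝ≥0∞ :=
  cubeMaximal (fun y => u y ^ 2) x ^ (2⁻¹ : ℝ)

lemma lintegral_le_rpow_half_mul_measure_univ {X : Type*} [MeasurableSpace X] {μ : Measure X}
    {u : X → ℝ≥0∞} (hu : AEMeasurable u μ) :
    ∫⁻ y, u y ∂μ ≤ (∫⁻ y, u y ^ 2 ∂μ) ^ (2⁻¹ : ℝ) * μ Set.univ ^ (2⁻¹ : ℝ) := by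
  simpa using ENNReal.lintegral_mul_le_Lp_mul_Lq μ Real.HolderConjugate.two_two hu
    (aemeasurable_const (b := (1 : ℝ≥0∞)))

lemma ennreal_rpow_half_mul_self (a : ℝ≥0∞) : a ^ (2⁻¹ : ℝ) * a ^ (2⁻¹ : ℝ) = a := by
  rw [← ENNReal.rpow_add_of_nonneg _ _ (by norm_num) (by norm_num), ← two_mul,
    mul_inv_cancel₀ two_ne_zero, ENNReal.rpow_one]

variable {n : ℕ}

lemma setLIntegral_cube_le_cubeMaximalTwo {u : Rn n → ℝ≥0∞} (hu : AEMeasurable u) {a x : Rn n}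
    {ℓ : ℝ} (hℓ : 0 < ℓ) (hx : x ∈ cube a ℓ) :
    ∫⁻ y in cube a ℓ, u y ≤ volume (cube a ℓ) * cubeMaximalTwo u x := by
  refine (lintegral_le_rpow_half_mul_measure_univ hu.restrict).trans ?_
  rw [Measure.restrict_apply_univ]
  calc (∫⁻ y in cube a ℓ, u y ^ 2) ^ (2⁻¹ : ℝ) * volume (cube a ℓ) ^ (2⁻¹ : ℝ)
      ≤ (volume (cube a ℓ) * cubeMaximal (fun y => u y ^ 2) x) ^ (2⁻¹ : ℝ) *
          volume (cube a ℓ) ^ (2⁻¹ : ℝ) := by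
        gcongr
        rw [volume_cube]
        exact setLIntegral_cube_le (fun y => u y ^ 2) hℓ hx
    _ = _ := by
        rw [ENNReal.mul_rpow_of_nonneg _ _ (by norm_num), mul_right_comm,
          ennreal_rpow_half_mul_self, cubeMaximalTwo]

lemma cubeMaximal_le_cubeMaximalTwo {u : Rn n → ℝ≥0∞} (hu : AEMeasurable u) (x : Rn n) :
    cubeMaximal u x ≤ cubeMaximalTwo u x :=
  cubeMaximal_le_of_forall fun a ℓ hℓ hx => by
    rw [mul_comm, ← volume_cube a]
    exact setLIntegral_cube_le_cubeMaximalTwo hu hℓ hx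

lemma sq_mul_volume_lt_cubeMaximalTwo_le (hn : 1 ≤ n) (u : Rn n → ℝ≥0∞) (lam : ℝ≥0∞) :
    lam ^ 2 * volume {x | lam < cubeMaximalTwo u x} ≤ 5 ^ n * ∫⁻ x, u x ^ 2 := by
  simp only [cubeMaximalTwo, ENNReal.lt_rpow_inv_iff two_pos, ENNReal.rpow_two]
  exact mul_volume_lt_cubeMaximal_le hn _ _

lemma lintegral_enorm_sq_eq (f : L2Rn n) : ∫⁻ x, ‖f x‖ₑ ^ 2 = ‖f‖ₑ ^ 2 := by
  rw [Lp.enorm_def, eLpNorm_eq_lintegral_rpow_enorm_toReal (by simp) (by simp),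
    ← ENNReal.rpow_natCast, ← ENNReal.rpow_mul]
  simp

/-- The restriction of `f` to the closed ball with centre `x` and radius `δ`. -/
noncomputable def localPart (f : L2Rn n) (x : Rn n) (δ : ℝ) : L2Rn n :=
  ((Lp.memLp f).indicator (measurableSet_closedBall (x := x) (ε := δ))).toLp

lemma localPart_ae_eq (f : L2Rn n) (x : Rn n) (δ : ℝ) :
    localPart f x δ =ᵐ[volume] (Metric.closedBall x δ).indicator f :=
  MemLp.coeFn_toLp _

lemma lintegral_enorm_localPart_sq_le (hn : 1 ≤ n) (f : L2Rn n) (x : Rn n) {δ : ℝ} (hδ : 0 < δ) :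
    ∫⁻ y, ‖localPart f x δ y‖ₑ ^ 2 ≤ (4 * n) ^ n *
      (volume (centredCube x (δ / (4 * n))) * cubeMaximal (fun y => ‖f y‖ₑ ^ 2) x) := by
  calc ∫⁻ y, ‖localPart f x δ y‖ₑ ^ 2
      = ∫⁻ y in Metric.closedBall x δ, ‖f y‖ₑ ^ 2 := by
        rw [← lintegral_indicator measurableSet_closedBall]
        refine lintegral_congr_ae ((localPart_ae_eq f x δ).mono fun y hy => ?_)
        simp only [hy]
        by_cases h : y ∈ Metric.closedBall x δ <;> simp [h]
    _ ≤ ENNReal.ofReal (2 * δ) ^ n * cubeMaximal (fun y => ‖f y‖ₑ ^ 2) x :=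
        setLIntegral_closedBall_le (fun y => ‖f y‖ₑ ^ 2) hδ (by simpa using hδ.le)
    _ = _ := by
        have hδn : 2 * δ = (4 * n : ℕ) * (2 * (δ / (4 * n))) := by
          have : (0 : ℝ) < n := by exact_mod_cast hn
          push_cast
          field_simp
        rw [hδn, ENNReal.ofReal_mul (by positivity), ENNReal.ofReal_natCast, mul_pow,
          ← volume_centredCube x, ← mul_assoc]
        push_cast
        rfl

variable {S : L2Rn n →L[ℂ] L2Rn n} {K : Rn n → Rn n → ℂ} {A ε B : ℝ}

namespace IsL2SingularIntegral

lemma lintegral_enorm_apply_sq_le (hS : IsL2SingularIntegral S K A ε B) (f : L2Rn n) :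
    ∫⁻ x, ‖S f x‖ₑ ^ 2 ≤ B.toNNReal ^ 2 * ∫⁻ x, ‖f x‖ₑ ^ 2 := by
  rw [lintegral_enorm_sq_eq, lintegral_enorm_sq_eq, ← mul_pow]
  gcongr
  change _ ≤ ENNReal.ofReal B * _
  rw [← ofReal_norm, ← ofReal_norm, ← ENNReal.ofReal_mul ((norm_nonneg S).trans hS.norm_le)]
  exact ENNReal.ofReal_le_ofReal (S.le_of_opNorm_le hS.norm_le f)

lemma ae_apply_sub_localPart_eq (hS : IsL2SingularIntegral S K A ε B) (f : L2Rn n) (x : Rn n)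
    {δ : ℝ} (hδ : 0 < δ) :
    ∀ᵐ z, z ∈ Metric.ball x (δ / 2) →
      S f z - S (localPart f x δ) z = ∫ y in {y | δ < ‖x - y‖}, K z y * f y := by
  have hfar : ⇑(f - localPart f x δ) =ᵐ[volume] {y | δ < ‖x - y‖}.indicator f := by
    have hset : {y | δ < ‖x - y‖} = (Metric.closedBall x δ)ᶜ := by
      ext y
      simp [dist_eq_norm, norm_sub_rev x y]
    rw [hset, Set.indicator_compl]
    exact (Lp.coeFn_sub f (localPart f x δ)).trans (.sub .rfl (localPart_ae_eq f x δ))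
  have hzero : ∀ᵐ y, y ∈ Metric.ball x δ → (f - localPart f x δ) y = 0 := by
    filter_upwards [hfar] with y hy hyx
    rw [hy, Set.indicator_of_notMem]
    exact not_lt.2 (mem_ball_iff_norm'.1 hyx).le
  filter_upwards [hS.representation _ x δ hδ hzero,
    Lp.coeFn_sub (S f) (S (localPart f x δ))] with z hz hsub hzx
  rw [← Pi.sub_apply, ← hsub, ← map_sub, hz hzx,
    ← integral_indicator (measurableSet_lt_norm_sub x δ)]
  refine integral_congr_ae (hfar.mono fun y hy => ?_)
  simp only [hy, ← Set.indicator_mul_right]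

lemma ae_enorm_truncatedIntegral_le (hS : IsL2SingularIntegral S K A ε B) (hε : 0 < ε)
    {f : L2Rn n} (hf : Integrable f) (x : Rn n) {δ : ℝ} (hδ : 0 < δ) :
    ∀ᵐ z, ‖x - z‖ ≤ δ / 3 → ‖truncatedIntegral K δ f x‖ₑ ≤
      A.toNNReal * decayConst n ε * cubeMaximal (fun y => ‖f y‖ₑ) x + ‖S f z‖ₑ +
        ‖S (localPart f x δ) z‖ₑ := by
  filter_upwards [hS.ae_apply_sub_localPart_eq f x hδ] with z hz hxz
  have hfar := hz (mem_ball_iff_norm'.2 (by linarith))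
  calc ‖truncatedIntegral K δ f x‖ₑ
      = ‖(truncatedIntegral K δ f x - ∫ y in {y | δ < ‖x - y‖}, K z y * f y) + S f z -
          S (localPart f x δ) z‖ₑ := by rw [← hfar]; congr 1; ring
    _ ≤ _ := enorm_sub_le.trans (add_le_add_left ((enorm_add_le _ _).trans (add_le_add_left
        (hS.kernel.enorm_setIntegral_kernel_sub_le hε hδ hxz (by simpa using hδ.le) hf) _)) _)

lemma setLIntegral_enorm_apply_localPart_le (hS : IsL2SingularIntegral S K A ε B) (hn : 1 ≤ n)
    (f : L2Rn n) (x : Rn n) {δ : ℝ} (hδ : 0 < δ) :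
    ∫⁻ z in centredCube x (δ / (4 * n)), ‖S (localPart f x δ) z‖ₑ ≤
      volume (centredCube x (δ / (4 * n))) *
        (B.toNNReal * (4 * n) ^ n * cubeMaximalTwo (fun y => ‖f y‖ₑ) x) := by
  set V := volume (centredCube x (δ / (4 * n)))
  let M := cubeMaximal (fun y => ‖f y‖ₑ ^ 2) x
  have hn' : (1 : ℝ≥0∞) ≤ n := by exact_mod_cast hn
  calc ∫⁻ z in centredCube x (δ / (4 * n)), ‖S (localPart f x δ) z‖ₑ
      ≤ (∫⁻ z, ‖S (localPart f x δ) z‖ₑ ^ 2) ^ (2⁻¹ : ℝ) * V ^ (2⁻¹ : ℝ) := by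
        refine (lintegral_le_rpow_half_mul_measure_univ
          (Lp.aestronglyMeasurable _).enorm.restrict).trans ?_
        rw [Measure.restrict_apply_univ]
        gcongr
        exact Measure.restrict_le_self
    _ ≤ ((B.toNNReal * (4 * n) ^ n) ^ 2 * (V * M)) ^ (2⁻¹ : ℝ) * V ^ (2⁻¹ : ℝ) := by
        gcongr
        refine (hS.lintegral_enorm_apply_sq_le _).trans ?_
        rw [mul_pow, mul_assoc]
        gcongr
        exact (lintegral_enorm_localPart_sq_le hn f x hδ).trans (mul_le_mul_left
          (le_self_pow₀ (one_le_pow₀ (one_le_mul (by norm_num) hn')) two_ne_zero) _)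
    _ = _ := by
        rw [ENNReal.mul_rpow_of_nonneg _ _ (by norm_num),
          ENNReal.mul_rpow_of_nonneg _ _ (by norm_num), ← ENNReal.rpow_two,
          ENNReal.rpow_rpow_inv two_ne_zero, mul_assoc _ _ (V ^ _), mul_right_comm _ _ (V ^ _),
          ennreal_rpow_half_mul_self, mul_left_comm]
        rfl

end IsL2SingularIntegral

lemma norm_sub_le_of_mem_centredCube_div (hn : 1 ≤ n) {x z : Rn n} {δ : ℝ} (hδ : 0 < δ)
    (hz : z ∈ centredCube x (δ / (4 * n))) : ‖x - z‖ ≤ δ / 3 := by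
  have : (0 : ℝ) < n := by exact_mod_cast hn
  rw [norm_sub_rev]
  calc ‖z - x‖ ≤ n * (δ / (4 * n)) := norm_le_of_forall_abs_le (mem_centredCube.1 hz)
    _ = δ / 4 := by field_simp
    _ ≤ δ / 3 := by linarith

/-- The constant in Cotlar's inequality. -/
noncomputable def cotlarConst (n : ℕ) (A ε B : ℝ) : ℝ≥0 :=
  1 + A.toNNReal * decayConst n ε + B.toNNReal * (4 * n) ^ n

/-- Cotlar's inequality: the pointwise bound for the truncated integral at `x` by the values of
`S f` near `x` is averaged over a cube centred at `x`. -/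
theorem IsL2SingularIntegral.maximalSingularIntegral_le (hS : IsL2SingularIntegral S K A ε B)
    (hε : 0 < ε) (hn : 1 ≤ n) {f : L2Rn n} (hf : Integrable f) (x : Rn n) :
    maximalSingularIntegral K f x ≤ cotlarConst n A ε B *
      (cubeMaximalTwo (fun y => ‖f y‖ₑ) x + cubeMaximalTwo (fun y => ‖S f y‖ₑ) x) := by
  refine iSup_le fun δ => iSup_le fun hδ => ?_
  let Mf := cubeMaximalTwo (fun y => ‖f y‖ₑ) x
  let MSf := cubeMaximalTwo (fun y => ‖S f y‖ₑ) x
  have hr : 0 < δ / (4 * n) := by positivity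
  set Q := centredCube x (δ / (4 * n))
  have hxQ : x ∈ Q := mem_centredCube.2 fun i => by simpa using hr.le
  have hQ0 : volume Q ≠ 0 := by
    rw [volume_centredCube]
    exact pow_ne_zero _ (by simpa using hr)
  have hQtop : volume Q ≠ ∞ := by rw [volume_centredCube]; finiteness
  refine (ENNReal.mul_le_mul_iff_right hQ0 hQtop).1 ?_
  calc volume Q * ‖truncatedIntegral K δ f x‖ₑ
      = ∫⁻ _ in Q, ‖truncatedIntegral K δ f x‖ₑ := by rw [setLIntegral_const, mul_comm]
    _ ≤ ∫⁻ z in Q, (A.toNNReal * decayConst n ε * cubeMaximal (fun y => ‖f y‖ₑ) x + ‖S f z‖ₑ +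
          ‖S (localPart f x δ) z‖ₑ) := by
        refine setLIntegral_mono_ae' (measurableSet_cube _ _) ?_
        filter_upwards [hS.ae_enorm_truncatedIntegral_le hε hf x hδ] with z hz hzQ
        exact hz (norm_sub_le_of_mem_centredCube_div hn hδ hzQ)
    _ = volume Q * (A.toNNReal * decayConst n ε * cubeMaximal (fun y => ‖f y‖ₑ) x) +
          (∫⁻ z in Q, ‖S f z‖ₑ) + ∫⁻ z in Q, ‖S (localPart f x δ) z‖ₑ := by
        have hmeas (g : L2Rn n) : AEMeasurable (fun z => ‖g z‖ₑ) (volume.restrict Q) :=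
          (Lp.aestronglyMeasurable g).enorm.restrict
        rw [lintegral_add_right' _ (hmeas _), lintegral_add_right' _ (hmeas _), setLIntegral_const,
          mul_comm (volume Q)]
    _ ≤ volume Q * (A.toNNReal * decayConst n ε * Mf) + volume Q * MSf +
          volume Q * (B.toNNReal * (4 * n) ^ n * Mf) := by
        gcongr
        · exact cubeMaximal_le_cubeMaximalTwo (Lp.aestronglyMeasurable f).enorm x
        · exact setLIntegral_cube_le_cubeMaximalTwo (Lp.aestronglyMeasurable _).enorm
            (by positivity) hxQ
        · exact hS.setLIntegral_enorm_apply_localPart_le hn f x hδ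
    _ ≤ volume Q * (A.toNNReal * decayConst n ε * Mf) + volume Q * MSf +
          volume Q * (B.toNNReal * (4 * n) ^ n * Mf) + volume Q * (Mf +
            (A.toNNReal * decayConst n ε + B.toNNReal * (4 * n) ^ n) * MSf) := le_self_add
    _ = volume Q * (cotlarConst n A ε B * (Mf + MSf)) := by
        rw [cotlarConst]
        push_cast
        ring

/-- The constant in the weak-type `(2,2)` inequality. -/
noncomputable def weakTwoConst (n : ℕ) (A ε B : ℝ) : ℝ≥0 :=
  (2 * cotlarConst n A ε B) ^ 2 * (5 ^ n * (1 + B.toNNReal ^ 2))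

theorem IsL2SingularIntegral.sq_mul_volume_lt_maximalSingularIntegral_le
    (hS : IsL2SingularIntegral S K A ε B) (hε : 0 < ε) (hn : 1 ≤ n) {f : L2Rn n}
    (hf : Integrable f) (lam : ℝ≥0∞) :
    lam ^ 2 * volume {x | lam < maximalSingularIntegral K f x} ≤
      weakTwoConst n A ε B * ∫⁻ x, ‖f x‖ₑ ^ 2 := by
  let C : ℝ≥0∞ := 2 * cotlarConst n A ε B
  have hC0 : C ≠ 0 := by simp [C, cotlarConst]
  have hC : C * (lam / C) = lam := ENNReal.mul_div_cancel hC0 (by finiteness)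
  have hsub : {x | lam < maximalSingularIntegral K f x} ⊆
      {x | lam / C < cubeMaximalTwo (fun y => ‖f y‖ₑ) x} ∪
        {x | lam / C < cubeMaximalTwo (fun y => ‖S f y‖ₑ) x} := by
    intro x hx
    contrapose! hx
    simp only [Set.mem_union, Set.mem_ofPred_eq, not_or, not_lt] at hx ⊢
    calc maximalSingularIntegral K f x ≤ cotlarConst n A ε B * (lam / C + lam / C) :=
          (hS.maximalSingularIntegral_le hε hn hf x).trans (by gcongr; exacts [hx.1, hx.2])
      _ = lam := by rw [← two_mul, ← mul_assoc, mul_comm _ 2, hC]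
  calc lam ^ 2 * volume {x | lam < maximalSingularIntegral K f x}
      ≤ C ^ 2 * ((lam / C) ^ 2 * volume {x | lam / C < cubeMaximalTwo (fun y => ‖f y‖ₑ) x} +
          (lam / C) ^ 2 * volume {x | lam / C < cubeMaximalTwo (fun y => ‖S f y‖ₑ) x}) := by
        rw [← mul_add, ← mul_assoc, ← mul_pow, hC]
        gcongr
        exact (measure_mono hsub).trans (measure_union_le _ _)
    _ ≤ C ^ 2 * (5 ^ n * (∫⁻ x, ‖f x‖ₑ ^ 2) +
          5 ^ n * (B.toNNReal ^ 2 * ∫⁻ x, ‖f x‖ₑ ^ 2)) := by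
        refine mul_le_mul_right (add_le_add (sq_mul_volume_lt_cubeMaximalTwo_le hn _ _)
          ((sq_mul_volume_lt_cubeMaximalTwo_le hn _ _).trans ?_)) _
        gcongr
        exact hS.lintegral_enorm_apply_sq_le f
    _ = _ := by
        rw [weakTwoConst]
        push_cast
        ring

end Cotlar

section PartitionAverage

variable {X E ι : Type*} [MeasurableSpace X] [NormedAddCommGroup E] [NormedSpace ℝ E]
  {μ : Measure X} {Q : ι → Set X} {F : X → E}

lemma measure_mul_enorm_setAverage_le (μ : Measure X) (s : Set X) (F : X → E) :
    μ s * ‖⨍ y in s, F y ∂μ‖ₑ ≤ ∫⁻ y in s, ‖F y‖ₑ ∂μ := by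
  rcases eq_or_ne (μ s) ∞ with hs | hs
  · simp [setAverage_eq, measureReal_def, hs]
  · have hμ : ‖μ.real s‖ₑ = μ s := by
      rw [Real.enorm_eq_ofReal measureReal_nonneg, ofReal_measureReal hs]
    rw [← hμ, ← enorm_smul, measure_smul_setAverage F hs]
    exact enorm_integral_le_lintegral_enorm _

open Classical in
/-- The function equal to the mean of `F` over `Q i` on each set `Q i` of a disjoint family, and to
`F` off the union of the family: the good part of a Calderón-Zygmund decomposition. -/
noncomputable def partitionAverage (μ : Measure X) (Q : ι → Set X) (F : X → E) (x : X) : E :=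
  if h : ∃ i, x ∈ Q i then ⨍ y in Q h.choose, F y ∂μ else F x

lemma partitionAverage_of_mem (hQ : Pairwise fun i j => Disjoint (Q i) (Q j)) {i : ι} {x : X}
    (hx : x ∈ Q i) : partitionAverage μ Q F x = ⨍ y in Q i, F y ∂μ := by
  have h : ∃ j, x ∈ Q j := ⟨i, hx⟩
  rw [partitionAverage, dif_pos h,
    hQ.eq (Set.not_disjoint_iff.2 ⟨x, h.choose_spec, hx⟩)]

lemma partitionAverage_of_notMem {x : X} (hx : ∀ i, x ∉ Q i) : partitionAverage μ Q F x = F x :=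
  dif_neg fun ⟨i, hi⟩ => hx i hi

lemma aestronglyMeasurable_partitionAverage [Countable ι] (hF : AEStronglyMeasurable F μ)
    (hm : ∀ i, MeasurableSet (Q i)) (hQ : Pairwise fun i j => Disjoint (Q i) (Q j)) :
    AEStronglyMeasurable (partitionAverage μ Q F) μ := by
  have hU : AEStronglyMeasurable (partitionAverage μ Q F) (μ.restrict (⋃ i, Q i)) := by
    refine AEStronglyMeasurable.iUnion fun i => ?_
    refine (aestronglyMeasurable_const (b := ⨍ y in Q i, F y ∂μ)).congr ?_
    filter_upwards [ae_restrict_mem (hm i)] with x hx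
    exact (partitionAverage_of_mem hQ hx).symm
  have hUc : AEStronglyMeasurable (partitionAverage μ Q F) (μ.restrict (⋃ i, Q i)ᶜ) := by
    refine hF.restrict.congr ?_
    filter_upwards [ae_restrict_mem (MeasurableSet.iUnion hm).compl] with x hx
    exact (partitionAverage_of_notMem fun i hi => hx (Set.mem_iUnion_of_mem i hi)).symm
  have h := aestronglyMeasurable_union_iff.2 ⟨hU, hUc⟩
  rwa [Set.union_compl_self, Measure.restrict_univ] at h

lemma lintegral_enorm_partitionAverage_le [Countable ι] (hm : ∀ i, MeasurableSet (Q i))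
    (hQ : Pairwise fun i j => Disjoint (Q i) (Q j)) :
    ∫⁻ x, ‖partitionAverage μ Q F x‖ₑ ∂μ ≤ ∫⁻ x, ‖F x‖ₑ ∂μ := by
  have hU : MeasurableSet (⋃ i, Q i) := .iUnion hm
  rw [← lintegral_add_compl _ hU, ← lintegral_add_compl (fun x => ‖F x‖ₑ) hU,
    lintegral_iUnion hm hQ, lintegral_iUnion hm hQ]
  refine add_le_add (ENNReal.tsum_le_tsum fun i => ?_) (le_of_eq ?_)
  · refine le_trans (le_of_eq ?_) (measure_mul_enorm_setAverage_le μ (Q i) F)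
    rw [mul_comm, ← setLIntegral_const]
    exact setLIntegral_congr_fun (hm i) fun x hx => by rw [partitionAverage_of_mem hQ hx]
  · exact setLIntegral_congr_fun hU.compl fun x hx => by
      rw [partitionAverage_of_notMem fun i hi => hx (Set.mem_iUnion_of_mem i hi)]

lemma integrable_partitionAverage [Countable ι] (hF : Integrable F μ)
    (hm : ∀ i, MeasurableSet (Q i)) (hQ : Pairwise fun i j => Disjoint (Q i) (Q j)) :
    Integrable (partitionAverage μ Q F) μ :=
  ⟨aestronglyMeasurable_partitionAverage hF.1 hm hQ,
    (lintegral_enorm_partitionAverage_le hm hQ).trans_lt hF.2⟩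

lemma lintegral_enorm_sub_partitionAverage_le [Countable ι] (hF : AEStronglyMeasurable F μ)
    (hm : ∀ i, MeasurableSet (Q i)) (hQ : Pairwise fun i j => Disjoint (Q i) (Q j)) :
    ∫⁻ x, ‖F x - partitionAverage μ Q F x‖ₑ ∂μ ≤ 2 * ∫⁻ x, ‖F x‖ₑ ∂μ :=
  calc ∫⁻ x, ‖F x - partitionAverage μ Q F x‖ₑ ∂μ
      ≤ ∫⁻ x, (‖F x‖ₑ + ‖partitionAverage μ Q F x‖ₑ) ∂μ := lintegral_mono fun x => enorm_sub_le
    _ = (∫⁻ x, ‖F x‖ₑ ∂μ) + ∫⁻ x, ‖partitionAverage μ Q F x‖ₑ ∂μ := lintegral_add_left' hF.enorm _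
    _ ≤ 2 * ∫⁻ x, ‖F x‖ₑ ∂μ := by
      rw [two_mul]
      exact add_le_add le_rfl (lintegral_enorm_partitionAverage_le hm hQ)

lemma setIntegral_sub_partitionAverage [Countable ι] [CompleteSpace E] (hF : Integrable F μ)
    (hm : ∀ i, MeasurableSet (Q i)) (hQ : Pairwise fun i j => Disjoint (Q i) (Q j)) {i : ι}
    (hi : μ (Q i) ≠ ∞) : ∫ x in Q i, (F x - partitionAverage μ Q F x) ∂μ = 0 := by
  rw [integral_sub hF.integrableOn (integrable_partitionAverage hF hm hQ).integrableOn,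
    setIntegral_congr_fun (hm i) fun x hx => partitionAverage_of_mem hQ hx, setIntegral_const,
    measure_smul_setAverage F hi, sub_self]

end PartitionAverage

section WeakType

variable {n : ℕ} {K : Rn n → Rn n → ℂ} {A ε B : ℝ}

lemma lintegral_enorm_sq_le_mul {X E : Type*} [MeasurableSpace X] {μ : Measure X}
    [NormedAddCommGroup E] {g : X → E} {C : ℝ≥0∞} (hg : AEStronglyMeasurable g μ)
    (hC : ∀ᵐ x ∂μ, ‖g x‖ₑ ≤ C) : ∫⁻ x, ‖g x‖ₑ ^ 2 ∂μ ≤ C * ∫⁻ x, ‖g x‖ₑ ∂μ := by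
  rw [← lintegral_const_mul'' C hg.enorm]
  refine lintegral_mono_ae (hC.mono fun x hx => ?_)
  rw [sq]
  gcongr

theorem IsL2SingularIntegral.mul_volume_lt_maximalSingularIntegral_le_of_ae_le
    {S : L2Rn n →L[ℂ] L2Rn n} (hS : IsL2SingularIntegral S K A ε B) (hε : 0 < ε) (hn : 1 ≤ n)
    {g : Rn n → ℂ} (hg : Integrable g) {lam : ℝ≥0∞} (h0 : lam ≠ 0) (htop : lam ≠ ∞) {C : ℝ≥0}
    (hC : ∀ᵐ x, ‖g x‖ₑ ≤ C * lam) :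
    lam * volume {x | lam < maximalSingularIntegral K g x} ≤
      weakTwoConst n A ε B * C * ∫⁻ x, ‖g x‖ₑ := by
  have hsq := lintegral_enorm_sq_le_mul hg.1 hC
  have hg2 : MemLp g 2 volume := by
    refine ⟨hg.1, (eLpNorm_lt_top_iff_lintegral_rpow_enorm_lt_top (by simp) (by simp)).2 ?_⟩
    have := hg.2.ne
    simpa using hsq.trans_lt (by finiteness)
  have hweak := hS.sq_mul_volume_lt_maximalSingularIntegral_le hε hn
    (hg.congr hg2.coeFn_toLp.symm) lam
  simp only [maximalSingularIntegral_congr_ae hg2.coeFn_toLp] at hweak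
  rw [lintegral_congr_ae (hg2.coeFn_toLp.mono fun x hx => by rw [hx])] at hweak
  refine (ENNReal.mul_le_mul_iff_right h0 htop).1 ?_
  calc lam * (lam * volume {x | lam < maximalSingularIntegral K g x})
      = lam ^ 2 * volume {x | lam < maximalSingularIntegral K g x} := by ring
    _ ≤ weakTwoConst n A ε B * (C * lam * ∫⁻ x, ‖g x‖ₑ) := hweak.trans (by gcongr)
    _ = lam * (weakTwoConst n A ε B * C * ∫⁻ x, ‖g x‖ₑ) := by ring

/-- The bound at `x`, far from the cube with corner `a` and side `r`, for the singular integral of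
the restriction of `b` to that cube when `b` has mean zero there. -/
noncomputable def cubeTail (A ε : ℝ) (b : Rn n → ℂ) (a : Rn n) (r : ℝ) (x : Rn n) : ℝ≥0∞ :=
  A.toNNReal * (ENNReal.ofReal ((n * r) ^ ε / ‖a - x‖ ^ (n + ε)) * ∫⁻ y in ocube a r, ‖b y‖ₑ)

lemma measurable_cubeTail (A ε : ℝ) (b : Rn n → ℂ) (a : Rn n) (r : ℝ) :
    Measurable (cubeTail A ε b a r) := by
  unfold cubeTail
  fun_prop

lemma setLIntegral_cubeTail_le (hn : 1 ≤ n) (hε : 0 < ε) (b : Rn n → ℂ) (a : Rn n) {r : ℝ}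
    (hr : 0 < r) :
    ∫⁻ x in (enlargedBall a r)ᶜ, cubeTail A ε b a r x ≤
      A.toNNReal * decayConst n ε * ∫⁻ y in ocube a r, ‖b y‖ₑ := by
  have hD : 0 < n * r := by positivity
  have hsub : (enlargedBall a r)ᶜ ⊆ {x | n * r < ‖a - x‖} := fun x hx => by
    rw [Set.mem_compl_iff, enlargedBall, mem_closedBall_iff_norm', not_le] at hx
    rw [Set.mem_ofPred_eq]
    linarith
  refine (lintegral_mono_set hsub).trans ?_
  unfold cubeTail
  rw [lintegral_const_mul' _ _ ENNReal.coe_ne_top, lintegral_mul_const _ (by fun_prop), mul_assoc]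
  gcongr
  have hdecay := setLIntegral_decay_le (fun _ : Rn n => 1) hε hD (x := a) (p := a)
    (by simp [hD.le])
  simp only [mul_one] at hdecay
  refine hdecay.trans (mul_le_of_le_one_right' ?_)
  exact cubeMaximal_le_of_ae_le (.of_forall fun _ => le_rfl) a

namespace IsStandardKernel

lemma enorm_setIntegral_ocube_le_cubeTail (hK : IsStandardKernel K A ε) (hε : 0 < ε)
    (hn : 1 ≤ n) {b : Rn n → ℂ} (hb : Integrable b) {a x : Rn n} {r : ℝ} (hr : 0 < r)
    (hmean : ∫ y in ocube a r, b y = 0) (hx : x ∉ enlargedBall a r) :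
    ‖∫ y in ocube a r, K x y * b y‖ₑ ≤ cubeTail A ε b a r x := by
  have hD : 0 < n * r := by positivity
  have hfar (y : Rn n) (hy : y ∈ ocube a r) : 3 * (n * r) < ‖x - y‖ := by
    rw [norm_sub_rev]
    exact lt_norm_sub_of_notMem_enlargedBall hr (ocube_subset_cube _ _ hy) hx
  have hint : IntegrableOn (fun y => K x y * b y) (ocube a r) :=
    (hK.integrableOn hε x (δ := 3 * (n * r)) (by positivity) hb).mono_set
      fun y hy => (hfar y hy).le
  have hcancel : ∫ y in ocube a r, K x y * b y = ∫ y in ocube a r, (K x y - K x a) * b y := by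
    simp only [sub_mul]
    rw [integral_sub hint (hb.integrableOn.const_mul _), integral_const_mul, hmean, mul_zero,
      sub_zero]
  rw [hcancel, cubeTail, ← lintegral_const_mul' _ _ ENNReal.ofReal_ne_top,
    ← lintegral_const_mul' _ _ ENNReal.coe_ne_top]
  refine (enorm_integral_le_lintegral_enorm _).trans
    (setLIntegral_mono' (measurableSet_ocube _ _) fun y hy => ?_)
  have hay : ‖a - y‖ ≤ n * r := norm_corner_sub_le_of_mem_cube hr (ocube_subset_cube _ _ hy)
  rw [enlargedBall, mem_closedBall_iff_norm', not_le] at hx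
  have hne : a ≠ x := sub_ne_zero.1 (norm_pos_iff.1 (by linarith))
  have hA := hK.const_nonneg hne
  rw [enorm_mul, ← mul_assoc]
  gcongr
  change _ ≤ ENNReal.ofReal A * _
  rw [← ENNReal.ofReal_mul hA, ← ofReal_norm, norm_sub_rev]
  refine ENNReal.ofReal_le_ofReal ?_
  calc ‖K x a - K x y‖ ≤ A * ‖a - y‖ ^ ε / ‖a - x‖ ^ (n + ε) := by
        linarith [hK.regularity a x y (by linarith), norm_nonneg (K a x - K y x)]
    _ ≤ A * ((n * r) ^ ε / ‖a - x‖ ^ (n + ε)) := by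
        rw [← mul_div_assoc]
        gcongr

/-- A cube not contained in `{y | δ < ‖x - y‖}` meets it only at distance comparable to `δ`
from `x`. -/
lemma enorm_setIntegral_inter_ocube_le (hK : IsStandardKernel K A ε) (hε : 0 < ε) (hn : 1 ≤ n)
    {b : Rn n → ℂ} (hb : Integrable b) {a x : Rn n} {r : ℝ} (hr : 0 < r)
    (hmean : ∫ y in ocube a r, b y = 0) (hx : x ∉ enlargedBall a r) (δ : ℝ) :
    ‖∫ y in ocube a r ∩ {y | δ < ‖x - y‖}, K x y * b y‖ₑ ≤ cubeTail A ε b a r x +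
      ∫⁻ y in ocube a r ∩ {y | 3 * δ / 4 ≤ ‖x - y‖ ∧ ‖x - y‖ ≤ 2 * (3 * δ / 4)},
        ‖K x y * b y‖ₑ := by
  by_cases hall : ∀ y ∈ ocube a r, δ < ‖x - y‖
  · rw [Set.inter_eq_left.2 (show ocube a r ⊆ {y | δ < ‖x - y‖} from hall)]
    exact le_add_right (hK.enorm_setIntegral_ocube_le_cubeTail hε hn hb hr hmean hx)
  push Not at hall
  obtain ⟨z, hz, hzδ⟩ := hall
  have hD : 0 < n * r := by positivity
  have hfar := lt_norm_sub_of_notMem_enlargedBall hr (ocube_subset_cube _ _ hz) hx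
  rw [norm_sub_rev] at hfar
  refine le_add_left ((enorm_integral_le_lintegral_enorm _).trans (lintegral_mono_set ?_))
  rintro y ⟨hy, hyδ⟩
  rw [Set.mem_ofPred_eq] at hyδ
  have hzy := norm_sub_le_of_mem_cube (ocube_subset_cube _ _ hz) (ocube_subset_cube _ _ hy)
  have htri := norm_sub_le_norm_sub_add_norm_sub x z y
  exact ⟨hy, by linarith, by linarith⟩

theorem maximalSingularIntegral_le_tsum_cubeTail (hK : IsStandardKernel K A ε) (hε : 0 < ε)
    (hn : 1 ≤ n) {b : Rn n → ℂ} (hb : Integrable b) {ι : Type*} [Countable ι] {a : ι → Rn n}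
    {r : ι → ℝ} (hr : ∀ i, 0 < r i)
    (hdisj : Pairwise fun i j => Disjoint (ocube (a i) (r i)) (ocube (a j) (r j)))
    (hmean : ∀ i, ∫ y in ocube (a i) (r i), b y = 0)
    (hsupp : ∀ y, (∀ i, y ∉ ocube (a i) (r i)) → b y = 0) {x : Rn n}
    (hx : ∀ i, x ∉ enlargedBall (a i) (r i)) :
    maximalSingularIntegral K b x ≤ (∑' i, cubeTail A ε b (a i) (r i) x) +
      A.toNNReal * 4 ^ n * cubeMaximal (fun y => ‖b y‖ₑ) x := by
  refine iSup_le fun δ => iSup_le fun hδ => ?_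
  let far : Set (Rn n) := {y | δ < ‖x - y‖}
  let ring : Set (Rn n) := {y | 3 * δ / 4 ≤ ‖x - y‖ ∧ ‖x - y‖ ≤ 2 * (3 * δ / 4)}
  have hnorm : Measurable fun y : Rn n => ‖x - y‖ := by fun_prop
  have hring : MeasurableSet ring := (measurableSet_le measurable_const hnorm).inter
    (measurableSet_le hnorm measurable_const)
  have hfar : MeasurableSet far := measurableSet_lt_norm_sub x δ
  have hdisj' (s : Set (Rn n)) : Pairwise fun i j =>
      Disjoint (ocube (a i) (r i) ∩ s) (ocube (a j) (r j) ∩ s) := fun i j hij =>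
    (hdisj hij).mono Set.inter_subset_left Set.inter_subset_left
  have hU : (⋃ i, ocube (a i) (r i) ∩ far) ⊆ far :=
    Set.iUnion_subset fun i => Set.inter_subset_right
  have hsum : truncatedIntegral K δ b x = ∑' i, ∫ y in ocube (a i) (r i) ∩ far, K x y * b y := by
    rw [← integral_iUnion (fun i => (measurableSet_ocube _ _).inter hfar) (hdisj' far)
      ((hK.integrableOn_lt hε x hδ hb).mono_set hU), truncatedIntegral]
    refine setIntegral_eq_of_subset_of_forall_sdiff_eq_zero hfar hU fun y hy => ?_
    rw [hsupp y fun i hi => hy.2 (Set.mem_iUnion_of_mem i ⟨hi, hy.1⟩), mul_zero]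
  calc ‖truncatedIntegral K δ b x‖ₑ
      ≤ ∑' i, ‖∫ y in ocube (a i) (r i) ∩ far, K x y * b y‖ₑ :=
        hsum ▸ enorm_tsum_le_tsum_enorm
    _ ≤ ∑' i, (cubeTail A ε b (a i) (r i) x +
          ∫⁻ y in ocube (a i) (r i) ∩ ring, ‖K x y * b y‖ₑ) :=
        ENNReal.tsum_le_tsum fun i =>
          hK.enorm_setIntegral_inter_ocube_le hε hn hb (hr i) (hmean i) (hx i) δ
    _ = (∑' i, cubeTail A ε b (a i) (r i) x) +
          ∫⁻ y in ⋃ i, ocube (a i) (r i) ∩ ring, ‖K x y * b y‖ₑ := by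
        rw [ENNReal.tsum_add,
          lintegral_iUnion (fun i => (measurableSet_ocube _ _).inter hring) (hdisj' ring)]
    _ ≤ _ := by
        gcongr
        refine (lintegral_mono_set (Set.iUnion_subset fun i => Set.inter_subset_right)).trans ?_
        exact hK.setLIntegral_annulus_le (by positivity) (by rw [sub_self, norm_zero]; positivity) b

end IsStandardKernel

lemma setLIntegral_tsum_cubeTail_le (hn : 1 ≤ n) (hε : 0 < ε) (b : Rn n → ℂ) {ι : Type*}
    [Countable ι] {a : ι → Rn n} {r : ι → ℝ} (hr : ∀ i, 0 < r i)
    (hdisj : Pairwise fun i j => Disjoint (ocube (a i) (r i)) (ocube (a j) (r j))) :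
    ∫⁻ x in (⋃ i, enlargedBall (a i) (r i))ᶜ, ∑' i, cubeTail A ε b (a i) (r i) x ≤
      A.toNNReal * decayConst n ε * ∫⁻ y, ‖b y‖ₑ := by
  rw [lintegral_tsum fun i => (measurable_cubeTail A ε b _ _).aemeasurable]
  calc ∑' i, ∫⁻ x in (⋃ i, enlargedBall (a i) (r i))ᶜ, cubeTail A ε b (a i) (r i) x
      ≤ ∑' i, A.toNNReal * decayConst n ε * ∫⁻ y in ocube (a i) (r i), ‖b y‖ₑ :=
        ENNReal.tsum_le_tsum fun i =>
          (lintegral_mono_set (Set.compl_subset_compl.2 (Set.subset_iUnion _ i))).trans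
            (setLIntegral_cubeTail_le hn hε b (a i) (hr i))
    _ = A.toNNReal * decayConst n ε * ∫⁻ y in ⋃ i, ocube (a i) (r i), ‖b y‖ₑ := by
        rw [ENNReal.tsum_mul_left, lintegral_iUnion (fun i => measurableSet_ocube _ _) hdisj]
    _ ≤ _ := by
        gcongr
        exact Measure.restrict_le_self

lemma mul_volume_lt_const_mul_cubeMaximal_le (hn : 1 ≤ n) (u : Rn n → ℝ≥0∞) (c : ℝ≥0)
    (lam : ℝ≥0∞) :
    lam * volume {x | lam < c * cubeMaximal u x} ≤ c * 5 ^ n * ∫⁻ y, u y := by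
  rcases eq_or_ne c 0 with rfl | hc
  · simp
  have hc' : (c : ℝ≥0∞) ≠ 0 := by exact_mod_cast hc
  calc lam * volume {x | lam < c * cubeMaximal u x}
      = c * (lam / c * volume {x | lam / c < cubeMaximal u x}) := by
        simp_rw [ENNReal.div_lt_iff (.inl hc') (.inl ENNReal.coe_ne_top), mul_comm _ (c : ℝ≥0∞)]
        rw [← mul_assoc, ENNReal.mul_div_cancel hc' ENNReal.coe_ne_top]
    _ ≤ c * (5 ^ n * ∫⁻ y, u y) := mul_le_mul_right (mul_volume_lt_cubeMaximal_le hn u _) _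
    _ = _ := (mul_assoc _ _ _).symm

theorem IsStandardKernel.mul_volume_lt_maximalSingularIntegral_off_enlargedBalls_le
    (hK : IsStandardKernel K A ε) (hε : 0 < ε)
    (hn : 1 ≤ n) {b : Rn n → ℂ} (hb : Integrable b) {ι : Type*} [Countable ι] {a : ι → Rn n}
    {r : ι → ℝ} (hr : ∀ i, 0 < r i)
    (hdisj : Pairwise fun i j => Disjoint (ocube (a i) (r i)) (ocube (a j) (r j)))
    (hmean : ∀ i, ∫ y in ocube (a i) (r i), b y = 0)
    (hsupp : ∀ y, (∀ i, y ∉ ocube (a i) (r i)) → b y = 0) (lam : ℝ≥0∞) :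
    lam * volume ({x | 2 * lam < maximalSingularIntegral K b x} ∩
        (⋃ i, enlargedBall (a i) (r i))ᶜ) ≤
      A.toNNReal * (decayConst n ε + 4 ^ n * 5 ^ n) * ∫⁻ y, ‖b y‖ₑ := by
  let U : Set (Rn n) := ⋃ i, enlargedBall (a i) (r i)
  let H (x : Rn n) : ℝ≥0∞ := ∑' i, cubeTail A ε b (a i) (r i) x
  have hH : Measurable H := .tsum fun i => measurable_cubeTail A ε b _ _
  let M : Set (Rn n) := {x | lam < (A.toNNReal * 4 ^ n : ℝ≥0) * cubeMaximal (fun y => ‖b y‖ₑ) x}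
  have hsub : {x | 2 * lam < maximalSingularIntegral K b x} ∩ Uᶜ ⊆ {x | lam ≤ H x} ∩ Uᶜ ∪ M := by
    rintro x ⟨hx, hxU⟩
    by_contra! hout
    have hH' : H x ≤ lam := le_of_not_ge fun h => hout (.inl ⟨h, hxU⟩)
    have hM : _ ≤ lam := not_lt.1 fun h => hout (.inr h)
    refine hx.not_ge ((hK.maximalSingularIntegral_le_tsum_cubeTail hε hn hb hr hdisj hmean hsupp
      fun i hi => hxU (Set.mem_iUnion_of_mem i hi)).trans ?_)
    push_cast at hM
    exact (add_le_add hH' hM).trans_eq (two_mul lam).symm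
  calc lam * volume ({x | 2 * lam < maximalSingularIntegral K b x} ∩ Uᶜ)
      ≤ lam * volume ({x | lam ≤ H x} ∩ Uᶜ) + lam * volume M := by
        rw [← mul_add]
        exact mul_le_mul_right ((measure_mono hsub).trans (measure_union_le _ _)) _
    _ ≤ A.toNNReal * decayConst n ε * (∫⁻ y, ‖b y‖ₑ) +
          (A.toNNReal * 4 ^ n : ℝ≥0) * 5 ^ n * ∫⁻ y, ‖b y‖ₑ := by
        refine add_le_add ?_ (mul_volume_lt_const_mul_cubeMaximal_le hn _ _ _)
        refine le_trans ?_ (setLIntegral_tsum_cubeTail_le hn hε b hr hdisj)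
        exact (mul_le_mul_right (Measure.le_restrict_apply _ _) _).trans
          (mul_meas_ge_le_lintegral hH lam)
    _ = _ := by
        push_cast
        ring

namespace IsStoppingFamily

variable {u : Rn n → ℝ≥0∞} {lam : ℝ≥0∞} {ι : Type} {a : ι → Rn n} {r : ι → ℝ}

lemma ae_enorm_partitionAverage_le {F : Rn n → ℂ}
    (h : IsStoppingFamily (fun x => ‖F x‖ₑ) lam a r) :
    ∀ᵐ x, ‖partitionAverage volume (fun i => ocube (a i) (r i)) F x‖ₑ ≤ 2 ^ n * lam := by
  filter_upwards [h.ae_le] with x hx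
  by_cases hmem : ∃ i, x ∈ ocube (a i) (r i)
  · obtain ⟨i, hi⟩ := hmem
    have hr : ENNReal.ofReal (r i) ^ n ≠ 0 := pow_ne_zero _ (by simpa using h.side_pos i)
    rw [partitionAverage_of_mem h.disjoint hi, ← ENNReal.mul_le_mul_iff_right hr (by finiteness)]
    calc ENNReal.ofReal (r i) ^ n * ‖⨍ y in ocube (a i) (r i), F y‖ₑ
        ≤ ∫⁻ y in ocube (a i) (r i), ‖F y‖ₑ :=
          volume_ocube (a i) (r i) ▸ measure_mul_enorm_setAverage_le _ _ _
      _ ≤ 2 ^ n * (lam * ENNReal.ofReal (r i) ^ n) := h.setLIntegral_le i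
      _ = ENNReal.ofReal (r i) ^ n * (2 ^ n * lam) := by ring
  · push Not at hmem
    rw [partitionAverage_of_notMem hmem]
    exact (hx hmem).trans (le_mul_of_one_le_left' (one_le_pow₀ one_le_two))

variable [Countable ι]

lemma mul_volume_iUnion_enlargedBall_le (h : IsStoppingFamily u lam a r) :
    lam * volume (⋃ i, enlargedBall (a i) (r i)) ≤ (8 * n) ^ n * ∫⁻ x, u x :=
  calc lam * volume (⋃ i, enlargedBall (a i) (r i))
      ≤ lam * ∑' i, (8 * n) ^ n * ENNReal.ofReal (r i) ^ n :=
        mul_le_mul_right ((measure_iUnion_le _).trans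
          (ENNReal.tsum_le_tsum fun i => volume_enlargedBall_le (a i) (r i))) _
    _ = (8 * n) ^ n * (lam * ∑' i, ENNReal.ofReal (r i) ^ n) := by
        rw [ENNReal.tsum_mul_left, mul_left_comm]
    _ ≤ _ := mul_le_mul_right h.mul_tsum_le _

end IsStoppingFamily

lemma exists_isStoppingFamily_of_integrable (hn : 1 ≤ n) {F : Rn n → ℂ} (hF : Integrable F)
    {lam : ℝ≥0∞} (h0 : lam ≠ 0) (htop : lam ≠ ∞) :
    ∃ (ι : Type) (_ : Countable ι) (a : ι → Rn n) (r : ι → ℝ),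
      IsStoppingFamily (fun x => ‖F x‖ₑ) lam a r := by
  let ℓ := max 1 ((∫⁻ x, ‖F x‖ₑ) / lam).toReal
  refine exists_isStoppingFamily hF.1.enorm htop (ℓ := ℓ) (by positivity) ?_
  have hℓ : (∫⁻ x, ‖F x‖ₑ) / lam ≤ ENNReal.ofReal ℓ :=
    (ENNReal.le_ofReal_iff_toReal_le (ENNReal.div_ne_top hF.2.ne h0) (by positivity)).2
      (le_max_right _ _)
  calc ∫⁻ x, ‖F x‖ₑ = lam * ((∫⁻ x, ‖F x‖ₑ) / lam) := (ENNReal.mul_div_cancel h0 htop).symm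
    _ ≤ lam * ENNReal.ofReal ℓ ^ n :=
      mul_le_mul_right (hℓ.trans (le_self_pow₀ (by simp [ℓ]) (by lia))) _

theorem IsStandardKernel.mul_volume_lt_maximalSingularIntegral_badPart_le
    (hK : IsStandardKernel K A ε) (hε : 0 < ε) (hn : 1 ≤ n) {F : Rn n → ℂ} (hF : Integrable F)
    {lam : ℝ≥0∞} {ι : Type} [Countable ι] {a : ι → Rn n} {r : ι → ℝ}
    (h : IsStoppingFamily (fun x => ‖F x‖ₑ) lam a r) :
    lam * volume {x | 2 * lam < maximalSingularIntegral K
        (F - partitionAverage volume (fun i => ocube (a i) (r i)) F) x} ≤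
      ((8 * n) ^ n + 2 * (A.toNNReal * (decayConst n ε + 4 ^ n * 5 ^ n))) * ∫⁻ x, ‖F x‖ₑ := by
  let b := F - partitionAverage volume (fun i => ocube (a i) (r i)) F
  let U := ⋃ i, enlargedBall (a i) (r i)
  have hQ (i : ι) : MeasurableSet (ocube (a i) (r i)) := measurableSet_ocube _ _
  have hmean (i : ι) : ∫ y in ocube (a i) (r i), b y = 0 :=
    setIntegral_sub_partitionAverage hF hQ h.disjoint (by rw [volume_ocube]; finiteness)
  have hsupp (y : Rn n) (hy : ∀ i, y ∉ ocube (a i) (r i)) : b y = 0 :=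
    sub_eq_zero.2 (partitionAverage_of_notMem hy).symm
  have hbF : ∫⁻ x, ‖b x‖ₑ ≤ 2 * ∫⁻ x, ‖F x‖ₑ :=
    lintegral_enorm_sub_partitionAverage_le hF.1 hQ h.disjoint
  have hoff := hK.mul_volume_lt_maximalSingularIntegral_off_enlargedBalls_le hε hn
    (hF.sub (integrable_partitionAverage hF hQ h.disjoint)) h.side_pos h.disjoint hmean hsupp lam
  calc lam * volume {x | 2 * lam < maximalSingularIntegral K b x}
      ≤ lam * volume U + lam * volume ({x | 2 * lam < maximalSingularIntegral K b x} ∩ Uᶜ) := by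
        rw [← mul_add]
        refine mul_le_mul_right ((measure_mono fun x hx => ?_).trans (measure_union_le _ _)) _
        exact (em (x ∈ U)).imp_right fun hxU => ⟨hx, hxU⟩
    _ ≤ (8 * n) ^ n * (∫⁻ x, ‖F x‖ₑ) +
          A.toNNReal * (decayConst n ε + 4 ^ n * 5 ^ n) * (2 * ∫⁻ x, ‖F x‖ₑ) :=
        add_le_add h.mul_volume_iUnion_enlargedBall_le (hoff.trans (mul_le_mul_right hbF _))
    _ = _ := by ring

/-- The constant of the weak-type `(1,1)` inequality for the maximal singular integral. -/
noncomputable def weakOneConst (n : ℕ) (A ε B : ℝ) : ℝ≥0 :=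
  weakTwoConst n A ε B * 2 ^ n +
    ((8 * n) ^ n + 2 * (A.toNNReal * (decayConst n ε + 4 ^ n * 5 ^ n)))

theorem IsL2SingularIntegral.mul_volume_lt_maximalSingularIntegral_le
    {S : L2Rn n →L[ℂ] L2Rn n} (hS : IsL2SingularIntegral S K A ε B) (hε : 0 < ε) (hn : 1 ≤ n)
    {F : Rn n → ℂ} (hF : Integrable F) {lam : ℝ≥0∞} (h0 : lam ≠ 0) (htop : lam ≠ ∞) :
    lam * volume {x | 3 * lam < maximalSingularIntegral K F x} ≤
      weakOneConst n A ε B * ∫⁻ x, ‖F x‖ₑ := by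
  obtain ⟨ι, _, a, r, hst⟩ := exists_isStoppingFamily_of_integrable hn hF h0 htop
  let g := partitionAverage volume (fun i => ocube (a i) (r i)) F
  have hQ (i : ι) : MeasurableSet (ocube (a i) (r i)) := measurableSet_ocube _ _
  have hg : Integrable g := integrable_partitionAverage hF hQ hst.disjoint
  have hgood := hS.mul_volume_lt_maximalSingularIntegral_le_of_ae_le hε hn hg h0 htop (C := 2 ^ n)
    (by simpa using hst.ae_enorm_partitionAverage_le)
  have hbad := hS.kernel.mul_volume_lt_maximalSingularIntegral_badPart_le hε hn hF hst
  have hsub : {x | 3 * lam < maximalSingularIntegral K F x} ⊆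
      {x | lam < maximalSingularIntegral K g x} ∪
        {x | 2 * lam < maximalSingularIntegral K (F - g) x} := fun x hx => by
    by_contra! hout
    rw [Set.mem_union, not_or, Set.mem_ofPred_eq, Set.mem_ofPred_eq, not_lt, not_lt] at hout
    have hle := hS.kernel.maximalSingularIntegral_add_le hε hg (hF.sub hg) x
    rw [add_sub_cancel] at hle
    exact hx.not_ge ((hle.trans (add_le_add hout.1 hout.2)).trans_eq (by ring))
  calc lam * volume {x | 3 * lam < maximalSingularIntegral K F x}
      ≤ lam * volume {x | lam < maximalSingularIntegral K g x} +
          lam * volume {x | 2 * lam < maximalSingularIntegral K (F - g) x} := by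
        rw [← mul_add]
        exact mul_le_mul_right ((measure_mono hsub).trans (measure_union_le _ _)) _
    _ ≤ weakTwoConst n A ε B * (2 ^ n : ℝ≥0) * (∫⁻ x, ‖F x‖ₑ) + _ :=
        add_le_add (hgood.trans (mul_le_mul_right
          (lintegral_enorm_partitionAverage_le hQ hst.disjoint) _)) hbad
    _ = _ := by
        rw [weakOneConst]
        push_cast
        ring

end WeakType

section Iteration

variable {n : ℕ} {K : Rn n → Rn n → ℂ} {A ε B : ℝ}

/-- The set on which the maximal singular integral or the maximal function of `F` is large
compared with `lam`. -/
def exceptionalSet (K : Rn n → Rn n → ℂ) (F : Rn n → ℂ) (lam : ℝ≥0∞) : Set (Rn n) :=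
  {x | 3 * lam < maximalSingularIntegral K F x} ∪ {x | lam < cubeMaximal (fun y => ‖F y‖ₑ) x}

lemma notMem_exceptionalSet {F : Rn n → ℂ} {lam : ℝ≥0∞} {x : Rn n} :
    x ∉ exceptionalSet K F lam ↔
      maximalSingularIntegral K F x ≤ 3 * lam ∧ cubeMaximal (fun y => ‖F y‖ₑ) x ≤ lam := by
  rw [exceptionalSet, Set.mem_union, not_or, Set.mem_ofPred_eq, Set.mem_ofPred_eq, not_lt, not_lt]

lemma IsL2SingularIntegral.mul_volume_exceptionalSet_le {S : L2Rn n →L[ℂ] L2Rn n}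
    (hS : IsL2SingularIntegral S K A ε B) (hε : 0 < ε) (hn : 1 ≤ n) {F : Rn n → ℂ}
    (hF : Integrable F) {lam : ℝ≥0∞} (h0 : lam ≠ 0) (htop : lam ≠ ∞) :
    lam * volume (exceptionalSet K F lam) ≤ (weakOneConst n A ε B + 5 ^ n) * ∫⁻ x, ‖F x‖ₑ := by
  rw [add_mul]
  refine (mul_le_mul_right (measure_union_le _ _) _).trans ?_
  rw [mul_add]
  exact add_le_add (hS.mul_volume_lt_maximalSingularIntegral_le hε hn hF h0 htop)
    (mul_volume_lt_cubeMaximal_le hn _ _)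

lemma IsStandardKernel.maximalSingularIntegral_le_add_of_notMem_exceptionalSet
    (hK : IsStandardKernel K A ε) (hε : 0 < ε) (hn : 1 ≤ n) {F : Rn n → ℂ} (hF : Integrable F)
    {lam : ℝ≥0∞} {a x x' : Rn n} {ℓ : ℝ} (hℓ : 0 < ℓ) (hx : x ∈ cube a ℓ) (hx' : x' ∈ cube a ℓ)
    (hout : x' ∉ exceptionalSet K F lam) :
    maximalSingularIntegral K F x ≤
      maximalSingularIntegral K ((enlargedBall a ℓ).indicator F) x +
        (3 + farConst n A ε) * lam := by
  obtain ⟨hT, hM⟩ := notMem_exceptionalSet.1 hout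
  have hball := measurableSet_enlargedBall a ℓ
  calc maximalSingularIntegral K F x
      = maximalSingularIntegral K
          ((enlargedBall a ℓ).indicator F + (enlargedBall a ℓ)ᶜ.indicator F) x := by
        rw [Set.indicator_self_add_compl]
    _ ≤ maximalSingularIntegral K ((enlargedBall a ℓ).indicator F) x +
          maximalSingularIntegral K ((enlargedBall a ℓ)ᶜ.indicator F) x :=
        hK.maximalSingularIntegral_add_le hε (hF.indicator hball) (hF.indicator hball.compl) x
    _ ≤ maximalSingularIntegral K ((enlargedBall a ℓ).indicator F) x +
          (3 * lam + farConst n A ε * lam) :=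
        add_le_add le_rfl
          ((hK.maximalSingularIntegral_compl_enlargedBall_le hε hn hℓ hx hx' hF).trans
            (add_le_add hT (mul_le_mul_right hM _)))
    _ = _ := by rw [add_mul]

/-- The multiple of the mean of `‖F‖` above which the exceptional set occupies at most the
fraction `2⁻¹ ^ (n + 2)` of the cube. -/
noncomputable def levelConst (n : ℕ) (A ε B : ℝ) : ℝ≥0 :=
  (weakOneConst n A ε B + 5 ^ n) * (8 * n) ^ n * 2 ^ (n + 2)

/-- The multiple of the maximal function lost in passing from a cube to the stopping cubes inside
it. -/
noncomputable def stepConst (n : ℕ) (A ε B : ℝ) : ℝ≥0 :=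
  (3 + farConst n A ε) * levelConst n A ε B

lemma levelConst_pos (hn : 1 ≤ n) (A ε B : ℝ) : 0 < levelConst n A ε B := by
  unfold levelConst
  positivity

lemma stepConst_pos (hn : 1 ≤ n) (A ε B : ℝ) : 0 < stepConst n A ε B :=
  mul_pos (by positivity) (levelConst_pos hn A ε B)

lemma IsL2SingularIntegral.volume_exceptionalSet_levelConst_mul_le {S : L2Rn n →L[ℂ] L2Rn n}
    (hS : IsL2SingularIntegral S K A ε B) (hε : 0 < ε) (hn : 1 ≤ n) {F : Rn n → ℂ}
    (hF : Integrable F) {ℓ : ℝ} {μ : ℝ≥0∞} (h0 : μ ≠ 0) (htop : μ ≠ ∞)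
    (hμ : ∫⁻ x, ‖F x‖ₑ ≤ (8 * n) ^ n * ENNReal.ofReal ℓ ^ n * μ) :
    2 ^ (n + 2) * volume (exceptionalSet K F (levelConst n A ε B * μ)) ≤ ENNReal.ofReal ℓ ^ n := by
  let lam := levelConst n A ε B * μ
  have hlam0 : lam ≠ 0 := mul_ne_zero (by exact_mod_cast (levelConst_pos hn A ε B).ne') h0
  have hlam : lam ≠ ∞ := by finiteness
  refine (ENNReal.mul_le_mul_iff_right hlam0 hlam).1 ?_
  calc lam * (2 ^ (n + 2) * volume (exceptionalSet K F lam))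
      = 2 ^ (n + 2) * (lam * volume (exceptionalSet K F lam)) := mul_left_comm _ _ _
    _ ≤ 2 ^ (n + 2) * ((weakOneConst n A ε B + 5 ^ n) *
          ((8 * n) ^ n * ENNReal.ofReal ℓ ^ n * μ)) :=
        mul_le_mul_right ((hS.mul_volume_exceptionalSet_le hε hn hF hlam0 hlam).trans
          (mul_le_mul_right hμ _)) _
    _ = lam * ENNReal.ofReal ℓ ^ n := by
        simp only [lam, levelConst]
        push_cast
        ring

lemma maximalSingularIntegral_eq_zero_of_ae_eq_zero {F : Rn n → ℂ} (hF : F =ᵐ[volume] 0)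
    (x : Rn n) : maximalSingularIntegral K F x = 0 := by
  rw [maximalSingularIntegral_congr_ae hF]
  simp [maximalSingularIntegral, truncatedIntegral]

/-- The stopping cubes are those of the exceptional set at `levelConst` times the mean of `‖F‖`,
which the maximal function dominates on the whole of the cube. -/
theorem IsL2SingularIntegral.exists_cubes_localizing {S : L2Rn n →L[ℂ] L2Rn n}
    (hS : IsL2SingularIntegral S K A ε B) (hε : 0 < ε) (hn : 1 ≤ n) {F : Rn n → ℂ}
    (hF : Integrable F) {a : Rn n} {ℓ : ℝ} (hℓ : 0 < ℓ)
    (hsupp : ∀ x, x ∉ enlargedBall a ℓ → F x = 0) :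
    ∃ (ι : Type) (_ : Countable ι) (c : ι → Rn n) (r : ι → ℝ), (∀ i, 0 < r i) ∧
      ∑' i, ENNReal.ofReal (r i) ^ n ≤ 2⁻¹ * ENNReal.ofReal ℓ ^ n ∧
      ∀ᵐ x, x ∈ cube a ℓ →
        stepConst n A ε B * cubeMaximal (fun y => ‖F y‖ₑ) x < maximalSingularIntegral K F x →
        ∃ i, x ∈ cube (c i) (r i) ∧ maximalSingularIntegral K F x ≤
          maximalSingularIntegral K ((enlargedBall (c i) (r i)).indicator F) x +
            stepConst n A ε B * cubeMaximal (fun y => ‖F y‖ₑ) x := by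
  rcases eq_or_ne (∫⁻ x, ‖F x‖ₑ) 0 with hF0 | hF0
  · have hFz : F =ᵐ[volume] 0 := by
      filter_upwards [(lintegral_eq_zero_iff' hF.1.enorm).1 hF0] with x hx
      exact enorm_eq_zero.1 hx
    refine ⟨Empty, inferInstance, Empty.elim, Empty.elim, fun i => i.elim, by simp,
      .of_forall fun x _ hx => ?_⟩
    simp [maximalSingularIntegral_eq_zero_of_ae_eq_zero hFz] at hx
  let V := (8 * n : ℝ≥0∞) ^ n * ENNReal.ofReal ℓ ^ n
  have hV0 : V ≠ 0 := mul_ne_zero (by simp) (pow_ne_zero _ (by simpa using hℓ))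
  have hV : V ≠ ∞ := by finiteness
  let μ := (∫⁻ x, ‖F x‖ₑ) / V
  let lam := levelConst n A ε B * μ
  have hμM {x : Rn n} (hx : x ∈ cube a ℓ) : μ ≤ cubeMaximal (fun y => ‖F y‖ₑ) x :=
    ENNReal.div_le_of_le_mul'
      (lintegral_le_mul_cubeMaximal hn hℓ (fun y hy => by rw [hsupp y hy, enorm_zero]) hx)
  have hstep {x : Rn n} (hx : x ∈ cube a ℓ) :
      (3 + farConst n A ε) * lam ≤ stepConst n A ε B * cubeMaximal (fun y => ‖F y‖ₑ) x := by
    rw [stepConst]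
    push_cast
    rw [← mul_assoc]
    exact mul_le_mul_right (hμM hx) _
  obtain ⟨ι, hι, c, r, hr, hsum, hout, hcov⟩ := exists_cubes_covering_of_volume_le hℓ
    (hS.volume_exceptionalSet_levelConst_mul_le hε hn hF
      (ENNReal.div_ne_zero.2 ⟨hF0, hV⟩) (ENNReal.div_ne_top hF.2.ne hV0)
      (ENNReal.mul_div_cancel hV0 hV).ge)
  refine ⟨ι, hι, c, r, hr, hsum, hcov.mono fun x hxcov hx hlt => ?_⟩
  have hxE : x ∈ exceptionalSet K F lam := by
    by_contra hxE
    refine hlt.not_ge ((notMem_exceptionalSet.1 hxE).1.trans (le_trans ?_ (hstep hx)))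
    exact mul_le_mul_left le_self_add _
  obtain ⟨i, hi⟩ := hxcov hxE
  obtain ⟨x', hx', hx'E⟩ := hout i
  exact ⟨i, hi, (hS.kernel.maximalSingularIntegral_le_add_of_notMem_exceptionalSet hε hn hF (hr i)
    hi hx' hx'E).trans (add_le_add le_rfl (hstep hx))⟩

theorem IsL2SingularIntegral.volume_mul_stepConst_lt_le {S : L2Rn n →L[ℂ] L2Rn n}
    (hS : IsL2SingularIntegral S K A ε B) (hε : 0 < ε) (hn : 1 ≤ n) (k : ℕ) {F : Rn n → ℂ}
    (hF : Integrable F) {a : Rn n} {ℓ : ℝ} (hℓ : 0 < ℓ)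
    (hsupp : ∀ x, x ∉ enlargedBall a ℓ → F x = 0) :
    volume {x ∈ cube a ℓ | k * stepConst n A ε B * cubeMaximal (fun y => ‖F y‖ₑ) x <
        maximalSingularIntegral K F x} ≤ 2⁻¹ ^ k * ENNReal.ofReal ℓ ^ n := by
  induction k generalizing F a ℓ with
  | zero =>
    rw [pow_zero, one_mul, ← volume_cube a ℓ]
    exact measure_mono fun x hx => hx.1
  | succ k ih =>
    obtain ⟨ι, _, c, r, hr, hsum, hloc⟩ := hS.exists_cubes_localizing hε hn hF hℓ hsupp
    let G (i : ι) : Rn n → ℂ := (enlargedBall (c i) (r i)).indicator F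
    have hGF (i : ι) (x : Rn n) :
        cubeMaximal (fun y => ‖G i y‖ₑ) x ≤ cubeMaximal (fun y => ‖F y‖ₑ) x :=
      cubeMaximal_mono (.of_forall fun y => enorm_indicator_le_enorm_self F y) x
    have hcover : {x ∈ cube a ℓ | (k + 1 : ℕ) * stepConst n A ε B *
          cubeMaximal (fun y => ‖F y‖ₑ) x < maximalSingularIntegral K F x} ≤ᵐ[volume]
        ⋃ i, {x ∈ cube (c i) (r i) | k * stepConst n A ε B * cubeMaximal (fun y => ‖G i y‖ₑ) x <
          maximalSingularIntegral K (G i) x} := by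
      filter_upwards [hloc] with x hx ⟨hxQ, hlt⟩
      push_cast at hlt
      rw [add_mul, add_mul, one_mul] at hlt
      obtain ⟨i, hxi, hle⟩ := hx hxQ (le_add_self.trans_lt hlt)
      exact Set.mem_iUnion_of_mem i ⟨hxi, (mul_le_mul_right (hGF i x) _).trans_lt
        (lt_of_add_lt_add_right (hlt.trans_le hle))⟩
    calc _ ≤ volume (⋃ i, {x ∈ cube (c i) (r i) | k * stepConst n A ε B *
            cubeMaximal (fun y => ‖G i y‖ₑ) x < maximalSingularIntegral K (G i) x}) :=
          measure_mono_ae hcover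
      _ ≤ ∑' i, 2⁻¹ ^ k * ENNReal.ofReal (r i) ^ n :=
          (measure_iUnion_le _).trans (ENNReal.tsum_le_tsum fun i =>
            ih (hF.indicator (measurableSet_enlargedBall _ _)) (hr i)
              fun x hx => Set.indicator_of_notMem hx F)
      _ ≤ 2⁻¹ ^ k * (2⁻¹ * ENNReal.ofReal ℓ ^ n) := by
          rw [ENNReal.tsum_mul_left]
          exact mul_le_mul_right hsum _
      _ = _ := by rw [pow_succ, mul_assoc]

lemma IsL2SingularIntegral.volume_mul_hlMaximal_lt_le {S : L2Rn n →L[ℂ] L2Rn n}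
    (hS : IsL2SingularIntegral S K A ε B) (hε : 0 < ε) (hn : 1 ≤ n) {a : Rn n} {ℓ : ℝ}
    (hℓ : 0 < ℓ) {f : Rn n → ℂ} (hf : Integrable f) (hsupp : ∀ᵐ x, x ∉ cube a ℓ → f x = 0)
    {k : ℕ} {t : ℝ≥0∞} (hk : k * stepConst n A ε B ≤ t) :
    volume {x ∈ cube a ℓ | t * hlMaximal f x < maximalSingularIntegral K f x} ≤
      2⁻¹ ^ k * ENNReal.ofReal ℓ ^ n := by
  let F := (cube a ℓ).indicator f
  have hFf : F =ᵐ[volume] f := hsupp.mono fun x hx => by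
    by_cases hxQ : x ∈ cube a ℓ <;> simp [F, hxQ, hx]
  have hsuppF (x : Rn n) (hx : x ∉ enlargedBall a ℓ) : F x = 0 :=
    Set.indicator_of_notMem (fun hxQ => hx (cube_subset_enlargedBall a hℓ hxQ)) f
  refine (measure_mono ?_).trans
    (hS.volume_mul_stepConst_lt_le hε hn k (hf.congr hFf.symm) hℓ hsuppF)
  rintro x ⟨hxQ, hx⟩
  refine ⟨hxQ, ?_⟩
  rw [maximalSingularIntegral_congr_ae hFf]
  exact (mul_le_mul' hk (cubeMaximal_mono (hFf.mono fun y hy => by rw [hy]) x)).trans_lt hx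

lemma floor_div_mul_le_ofReal {C : ℝ≥0} (hC : 0 < C) {t : ℝ} (ht : 0 ≤ t) :
    (⌊t / C⌋₊ : ℝ≥0∞) * C ≤ ENNReal.ofReal t := by
  rw [← ENNReal.ofReal_natCast, ← ENNReal.ofReal_coe_nnreal, ← ENNReal.ofReal_mul (by positivity)]
  refine ENNReal.ofReal_le_ofReal ((le_div_iff₀ (NNReal.coe_pos.2 hC)).1 ?_)
  exact Nat.floor_le (by positivity)

lemma inv_two_pow_floor_le (s : ℝ) :
    (2⁻¹ : ℝ≥0∞) ^ ⌊s⌋₊ ≤ ENNReal.ofReal (2 * Real.exp (-Real.log 2 * s)) := by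
  have hs : Real.exp (Real.log 2 * s) ≤ 2 * 2 ^ ⌊s⌋₊ := by
    rw [← Real.rpow_def_of_pos two_pos, ← pow_succ', ← Real.rpow_natCast]
    exact Real.rpow_le_rpow_of_exponent_le one_le_two
      (by exact_mod_cast (Nat.lt_floor_add_one s).le)
  rw [← ENNReal.ofReal_ofNat, ← ENNReal.ofReal_inv_of_pos two_pos,
    ← ENNReal.ofReal_pow (by simp), neg_mul, Real.exp_neg, inv_pow, ← div_eq_mul_inv]
  refine ENNReal.ofReal_le_ofReal ?_
  rw [inv_eq_one_div, div_le_div_iff₀ (by positivity) (by positivity), one_mul]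
  exact hs

end Iteration

lemma integrable_of_memLp_top_of_ae_eq_zero_off_cube {n : ℕ} {a : Rn n} {ℓ : ℝ} {f : Rn n → ℂ}
    (hf : MemLp f ∞ volume) (hsupp : ∀ᵐ x, x ∉ cube a ℓ → f x = 0) : Integrable f := by
  have : IsFiniteMeasure (volume.restrict (cube a ℓ)) :=
    ⟨by rw [Measure.restrict_apply_univ, volume_cube]; finiteness⟩
  exact IntegrableOn.integrable_of_ae_notMem_eq_zero ((hf.restrict _).integrable le_top) hsupp

theorem theorem2p2_general (n : ℕ) (hn : 1 ≤ n) (A ε B : ℝ) (hε : 0 < ε) :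
    ∃ c α : ℝ, 0 < c ∧ 0 < α ∧
      ∀ (T : SmoothCc n →ₗ[ℂ] (Rn n →ₘ[volume] ℂ)) (K : Rn n → Rn n → ℂ),
        IsCalderonZygmund T K A ε B →
        ∀ (a : Rn n) (ℓ : ℝ), 0 < ℓ →
        ∀ f : Rn n → ℂ, Integrable f → (∀ᵐ x, x ∉ cube a ℓ → f x = 0) →
        ∀ t : ℝ, 0 < t →
          volume {x ∈ cube a ℓ |
              ENNReal.ofReal t * hlMaximal f x < maximalSingularIntegral K f x}
            ≤ ENNReal.ofReal (c * Real.exp (-α * t)) * volume (cube a ℓ) := by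
  have hC := stepConst_pos hn A ε B
  refine ⟨2, Real.log 2 / stepConst n A ε B, two_pos, div_pos (Real.log_pos one_lt_two) hC, ?_⟩
  intro T K hT a ℓ hℓ f hf hsupp t ht
  obtain ⟨S, hS⟩ := hT.exists_isL2SingularIntegral hε hn
  calc _ ≤ 2⁻¹ ^ ⌊t / stepConst n A ε B⌋₊ * ENNReal.ofReal ℓ ^ n :=
        hS.volume_mul_hlMaximal_lt_le hε hn hℓ hf hsupp (floor_div_mul_le_ofReal hC ht.le)
    _ ≤ _ := by
        rw [volume_cube, ← neg_div, div_mul_eq_mul_div, mul_div_assoc]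
        exact mul_le_mul_left (inv_two_pow_floor_le _) _

theorem theorem2p2 (n : ℕ) (hn : 1 ≤ n) (A ε B : ℝ) (hε : 0 < ε) :
    ∃ c α : ℝ, 0 < c ∧ 0 < α ∧
      ∀ (T : SmoothCc n →ₗ[ℂ] (Rn n →ₘ[volume] ℂ)) (K : Rn n → Rn n → ℂ),
        IsCalderonZygmund T K A ε B →
        ∀ (a : Rn n) (ℓ : ℝ), 0 < ℓ →
        ∀ f : Rn n → ℂ, MemLp f ∞ volume → (∀ᵐ x, x ∉ cube a ℓ → f x = 0) →
        ∀ t : ℝ, 0 < t →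
          volume {x ∈ cube a ℓ |
              ENNReal.ofReal t * hlMaximal f x < maximalSingularIntegral K f x}
            ≤ ENNReal.ofReal (c * Real.exp (-α * t)) * volume (cube a ℓ) := by
  obtain ⟨c, α, hc, hα, h⟩ := theorem2p2_general n hn A ε B hε
  exact ⟨c, α, hc, hα, fun T K hT a ℓ hℓ f hf hsupp =>
    h T K hT a ℓ hℓ f (integrable_of_memLp_top_of_ae_eq_zero_off_cube hf hsupp) hsupp⟩
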